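/- Let $0<\alpha<2$ and let $(z(t))_{t\ge 0}$ be a nondegenerate one-dimensional $\alpha$-stable Lévy process on a probability space, that is: a càdlàg Lévy process without Gaussian part, with $$\mathbb E e^{i\xi z(t)}=e^{t\psi(\xi)},\qquad \psi(\xi)=ib\xi+\int_{\mathbb R\setminus\{0\}}\bigl(e^{i\xi y}-1-i\xi y\mathbf 1_{\{|y|\le 1\}}\bigr)\,\nu(dy),$$ where $b\in\mathbb R$ and $\nu$ is the Lévy measure of $z$; such that for every $a>0$ there is $c\in\mathbb R$ for which $z(at)$ has the same law as $a^{1/\alpha}z(t)+ct$ for all $t\ge0$; and such that $z(1)$ is not almost surely constant. (In particular, this covers the symmetric process with $\mathbb E e^{i\xi z(t)}=e^{-t|\xi|^\alpha}$, for which $\nu(dx)=c_\alpha|x|^{-\alpha-1}dx$.) For $K>0$ put $$\Gamma_K=(-\infty,-K]\cup[K,\infty),\qquad \gamma_K=\nu(\Gamma_K),\qquad \nu_K=\frac1{\gamma_K}\,\nu|_{\Gamma_K}.$$ There are functions $p_K:\mathbb R\to[0,\infty)$ and constants $\beta_1=\beta_1(K)$, $\beta_2=\beta_2(K)$, $\beta_0=\beta_0(K,M)$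 such that for every bounded Lipschitz map $F:\mathbb R^2\to\mathbb R^2$, with $\|F\|_{\rm Lip}=\sup_{x\ne y}|F(x)-F(y)|/|x-y|$, there is $K_0>0$ such that for all $K\in(0,K_0]$ and all $M>0$ one has $\beta_1,\beta_2>0$, $\beta_0\in(0,2)$, and the following conditions hold. (A1) For every $\lambda>0$ and every $t\ge0$ the stochastic integral $\int_0^t e^{-\lambda(t-s)}\,dz(s)$ exists, as the limit in probability of left-endpoint Riemann sums along every sequence of partitions of $[0,t]$ with mesh tending to $0$, and for every $p\in(0,\alpha)$ $$\sup_{0\le t<\infty}\mathbb E\left|\int_0^t e^{-\lambda(t-s)}\,dz(s)\right|^p<\infty .$$ (A2) $p_K$ is a density of $\nu_K$ with respect to Lebesgue measure, and for all $z_1,z_2\in\mathbb R$ $$\int_{\mathbb R}|p_K(z-z_1)-p_K(z-z_2)|\,dz\le\beta_1|z_1-z_2|^{\beta_2}.$$ (A3) For all $z_1,z_2\in\mathbb R$ with $|z_1|+|z_2|\le M$, $$\int_{\mathbb R}|p_K(z-z_1)-p_K(z-z_2)|\,dz\le\beta_0 .$$ (A4) $\gamma_K\ge 2\beta_2\|F\|_{\rm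 Lip}$. -/

import Mathlib

open MeasureTheory ProbabilityTheory Filter Topology
open scoped ENNReal NNReal

namespace StableNoise

noncomputable section

/-- `ν` is a Lévy measure on `ℝ`: no mass at the origin and `∫ min(1, y²) ν(dy) < ∞`. -/
structure IsLevyMeasure (ν : Measure ℝ) : Prop where
  zero : ν {0} = 0
  lintegral_lt_top : (∫⁻ y, ENNReal.ofReal (min 1 (y ^ 2)) ∂ν) < ∞

/-- The Lévy symbol with drift `b`, Lévy measure `ν` and no Gaussian part:
`ψ(ξ) = i b ξ + ∫ (e^{iξy} - 1 - iξy 1_{|y| ≤ 1}) ν(dy)`. -/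
def levySymbol (b : ℝ) (ν : Measure ℝ) (ξ : ℝ) : ℂ :=
  Complex.I * b * ξ +
    ∫ y : ℝ, (Complex.exp (Complex.I * ξ * y) - 1
      - Complex.I * ξ * Set.indicator {x : ℝ | |x| ≤ 1} (fun x => (x : ℂ)) y) ∂ν

/-- A path on `[0, ∞)` is càdlàg: right-continuous with left limits. -/
def IsCadlagPath (x : ℝ≥0 → ℝ) : Prop :=
  ∀ t, ContinuousWithinAt x (Set.Ici t) t ∧ ∃ l, Tendsto x (𝓝[<] t) (𝓝 l)

/-- A one-dimensional Lévy process. -/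
structure IsLevyProcess {Ω : Type*} [MeasurableSpace Ω] (z : ℝ≥0 → Ω → ℝ) (P : Measure Ω) :
    Prop where
  measurable : ∀ t, Measurable (z t)
  zero : ∀ᵐ ω ∂P, z 0 ω = 0
  indep : HasIndepIncrements z P
  stationary : ∀ s t, P.map (fun ω => z (s + t) ω - z s ω) = P.map (fun ω => z t ω - z 0 ω)
  stochCont : ∀ t, TendstoInMeasure P z (𝓝 t) (z t)
  cadlag : ∀ᵐ ω ∂P, IsCadlagPath (fun t => z t ω)

/-- `z` is a purely jumping Lévy process (possibly with a drift, but without Gaussian part) whose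
Lévy measure is `ν`. -/
structure IsJumpLevyProcess {Ω : Type*} [MeasurableSpace Ω] (z : ℝ≥0 → Ω → ℝ) (ν : Measure ℝ)
    (P : Measure Ω) : Prop where
  isLevyProcess : IsLevyProcess z P
  isLevyMeasure : IsLevyMeasure ν
  charFun_eq : ∃ b : ℝ, ∀ (t : ℝ≥0) (ξ : ℝ),
    charFun (P.map (z t)) ξ = Complex.exp ((t : ℝ) * levySymbol b ν ξ)

/-- The process `z` is (nondegenerate and) stable of index `α`: for every `a > 0` there is `c`
such that `z (a t)` has the law of `a^{1/α} z t + c t` for all `t`. -/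
structure IsStableProcess {Ω : Type*} [MeasurableSpace Ω] (α : ℝ) (z : ℝ≥0 → Ω → ℝ)
    (P : Measure Ω) : Prop where
  scaling : ∀ a : ℝ≥0, 0 < a → ∃ c : ℝ, ∀ t : ℝ≥0,
    P.map (z (a * t)) = P.map (fun ω => (a : ℝ) ^ (1 / α) * z t ω + c * t)
  nondegenerate : ¬ ∃ c : ℝ, P.map (z 1) = Measure.dirac c

/-- `I` is the stochastic integral `∫_0^t f(s) dz(s)` of the deterministic integrand `f`: the
limit in probability of the left-endpoint sums `∑ f(s_i) (z(s_{i+1}) - z(s_i))` along every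
sequence of partitions `0 = s_{n,0} ≤ … ≤ s_{n,k_n} = t` whose mesh tends to zero. -/
def IsStochIntegral {Ω : Type*} [MeasurableSpace Ω] (f : ℝ → ℝ) (z : ℝ≥0 → Ω → ℝ) (t : ℝ≥0)
    (I : Ω → ℝ) (P : Measure Ω) : Prop :=
  AEMeasurable I P ∧
  ∀ (k : ℕ → ℕ) (s : ℕ → ℕ → ℝ≥0), (∀ n, Monotone (s n)) → (∀ n, s n 0 = 0) →
    (∀ n, s n (k n) = t) →
    (∀ ε : ℝ, 0 < ε → ∀ᶠ n in atTop, ∀ i < k n, (s n (i + 1) : ℝ) - s n i ≤ ε) →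
    TendstoInMeasure P
      (fun n ω => ∑ i ∈ Finset.range (k n), f (s n i) * (z (s n (i + 1)) ω - z (s n i) ω))
      atTop I

/-- `Γ_K = (-∞, -K] ∪ [K, ∞)`. -/
def bigJumps (K : ℝ) : Set ℝ := Set.Iic (-K) ∪ Set.Ici K

/-- `γ_K = ν(Γ_K)`, finite for a Lévy measure `ν` and `K > 0`. -/
def jumpRate (ν : Measure ℝ) (K : ℝ) : ℝ := (ν (bigJumps K)).toReal

/-- `ν_K = γ_K⁻¹ ν|_{Γ_K}`, the law of the jumps of size at least `K`. -/
def jumpLaw (ν : Measure ℝ) (K : ℝ) : Measure ℝ :=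
  (ν (bigJumps K))⁻¹ • ν.restrict (bigJumps K)

/-- `p` is a density of `μ` with respect to Lebesgue measure. -/
structure IsDensity (p : ℝ → ℝ) (μ : Measure ℝ) : Prop where
  measurable : Measurable p
  nonneg : ∀ x, 0 ≤ p x
  eq_withDensity : μ = volume.withDensity (fun x => ENNReal.ofReal (p x))

/-- The plane with its Euclidean norm. -/
abbrev Plane : Type := EuclideanSpace ℝ (Fin 2)

/-- `‖F‖_Lip = sup_{x ≠ y} |F x - F y| / |x - y|`. -/
def lipSeminorm (F : Plane → Plane) : ℝ :=
  sSup {r : ℝ | ∃ x y : Plane, x ≠ y ∧ r = ‖F x - F y‖ / ‖x - y‖}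

/-- The conditions (A1)-(A4) on a process `z` with Lévy measure `ν` and a nonlinearity `F`, with
the jump threshold `K`, the density `pK` of `ν_K` and the constants `M, β₀, β₁, β₂` displayed. -/
structure NoiseAssumption {Ω : Type*} [MeasurableSpace Ω] (α : ℝ) (z : ℝ≥0 → Ω → ℝ)
    (ν : Measure ℝ) (P : Measure Ω) (F : Plane → Plane)
    (K : ℝ) (pK : ℝ → ℝ) (M β₀ β₁ β₂ : ℝ) : Prop where
  K_pos : 0 < K
  M_pos : 0 < M
  β₀_pos : 0 < β₀
  β₀_lt : β₀ < 2
  β₁_pos : 0 < β₁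
  β₂_pos : 0 < β₂
  density : IsDensity pK (jumpLaw ν K)
  A1 : ∀ lam : ℝ, 0 < lam → ∃ Y : ℝ≥0 → Ω → ℝ,
    (∀ t : ℝ≥0, IsStochIntegral (fun s => Real.exp (-lam * (t - s))) z t (Y t) P) ∧
    ∀ p : ℝ, 0 < p → p < α → (⨆ t : ℝ≥0, ∫⁻ ω, ‖Y t ω‖ₑ ^ p ∂P) < ∞
  A2 : ∀ z₁ z₂ : ℝ, (∫ x, |pK (x - z₁) - pK (x - z₂)|) ≤ β₁ * |z₁ - z₂| ^ β₂
  A3 : ∀ z₁ z₂ : ℝ, |z₁| + |z₂| ≤ M → (∫ x, |pK (x - z₁) - pK (x - z₂)|) ≤ β₀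
  A4 : 2 * β₂ * lipSeminorm F ≤ jumpRate ν K

end

end StableNoise

/-! Everything about jumps comes from homogeneity of `ν`. Comparing characteristic functions,
stability says that the symbol satisfies `ψ(sξ) = s^α ψ(ξ) - icξ`. Second differences of `ψ` remove
the linear term and are the characteristic functions of the finite measures `(2 - 2 cos(hy)) ν(dy)`,
so uniqueness gives `map_mul_eq_of_stable`: the image of `ν` under `y ↦ sy` is `s^α ν`. Hence
`ν([a,∞))` is proportional to `a^(-α)`, and `ν_K` is a mixture of a Pareto law and a reflected one
(`restrict_bigJumps_of_homogeneous`).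

A Pareto density vanishes left of `K` and decreases afterwards, so two translates at distance `d`
differ in L¹ by exactly `2(1 - (K/(K+d))^α)`. This is at most `(2α/K) d`, which is (A2) with `β₂ =
1`, and it stays below `2` for bounded `d`, which is (A3). For (A4), `γ_K = K^(-α) γ_1` tends to
infinity as `K → 0`.

For (A1), the integrand is C¹ and the paths are càdlàg, so Riemann sums converge pathwise by parts
(`tendsto_sum_mul_increments`). For the moments, `exists_charFun_sum_exp_bound` gives `1 - Re φ(ξ) ≤
C|ξ|^α` near `0`, uniformly over sums and times. Here `Re ψ` is exactly `α`-homogeneous, while `Im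
ψ` enters only squared, so the cruder order `α/2` suffices for it. Such a bound gives tails of order
`r^(-α)`, hence moments below `α`, and Fatou passes to the integral. -/

namespace StableNoise

/-! ### The Lévy symbol and its second differences. -/

/-- The compensated exponential `e^{iξy} - 1 - iξy 1_{|y| ≤ 1}`, integrated by the Lévy symbol. -/
noncomputable def compensatedExp (ξ y : ℝ) : ℂ :=
  Complex.exp (Complex.I * ξ * y) - 1
    - Complex.I * ξ * Set.indicator {x : ℝ | |x| ≤ 1} (fun x => (x : ℂ)) y

lemma levySymbol_eq (b : ℝ) (ν : Measure ℝ) (ξ : ℝ) :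
    levySymbol b ν ξ = Complex.I * b * ξ + ∫ y, compensatedExp ξ y ∂ν := rfl

lemma norm_exp_I_mul_sub_one_le_two (θ : ℝ) : ‖Complex.exp (Complex.I * θ) - 1‖ ≤ 2 := by
  refine (norm_sub_le _ _).trans ?_
  rw [mul_comm, Complex.norm_exp_ofReal_mul_I]
  norm_num

lemma norm_exp_I_mul_sub_one_sub_le (θ : ℝ) :
    ‖Complex.exp (Complex.I * θ) - 1 - Complex.I * θ‖ ≤ 3 * θ ^ 2 := by
  have hn : ‖Complex.I * (θ : ℂ)‖ = |θ| := by simp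
  rcases le_total |θ| 1 with h | h
  · have := Complex.norm_exp_sub_one_sub_id_le (x := Complex.I * θ) (hn ▸ h)
    rw [hn, sq_abs] at this
    nlinarith [sq_nonneg θ]
  · have h1 := norm_exp_I_mul_sub_one_le_two θ
    have h2 := norm_sub_le (Complex.exp (Complex.I * θ) - 1) (Complex.I * θ)
    rw [hn] at h2
    have h3 : |θ| ≤ θ ^ 2 := by rw [← sq_abs]; nlinarith
    nlinarith

lemma norm_compensatedExp_le_of_abs_le_one (ξ : ℝ) {y : ℝ} (hy : |y| ≤ 1) :
    ‖compensatedExp ξ y‖ ≤ 3 * (ξ * y) ^ 2 := by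
  have := norm_exp_I_mul_sub_one_sub_le (ξ * y)
  rw [compensatedExp, Set.indicator_of_mem (show y ∈ {x : ℝ | |x| ≤ 1} from hy)]
  push_cast at this
  simpa only [mul_assoc] using this

lemma norm_compensatedExp_le_of_one_lt_abs (ξ : ℝ) {y : ℝ} (hy : 1 < |y|) :
    ‖compensatedExp ξ y‖ ≤ min 2 |ξ * y| := by
  rw [compensatedExp, Set.indicator_of_notMem (show y ∉ {x : ℝ | |x| ≤ 1} from not_le.2 hy)]
  have h1 := norm_exp_I_mul_sub_one_le_two (ξ * y)
  have h2 := Real.norm_exp_I_mul_ofReal_sub_one_le (x := ξ * y)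
  push_cast at h1 h2
  rw [← mul_assoc] at h1 h2
  rw [Real.norm_eq_abs] at h2
  simpa [-abs_mul] using And.intro h1 h2

lemma measurable_compensatedExp (ξ : ℝ) : Measurable (compensatedExp ξ) := by
  unfold compensatedExp
  refine Measurable.sub (by fun_prop) (Measurable.const_mul ?_ _)
  exact Complex.measurable_ofReal.indicator (measurableSet_le measurable_id.abs measurable_const)

lemma IsLevyMeasure.integrable_min {ν : Measure ℝ} (hν : IsLevyMeasure ν) :
    Integrable (fun y : ℝ => min 1 (y ^ 2)) ν := by
  refine ⟨by fun_prop, ?_⟩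
  rw [hasFiniteIntegral_iff_ofReal (ae_of_all _ fun y => by positivity)]
  exact hν.lintegral_lt_top

lemma integrable_compensatedExp {ν : Measure ℝ} (hν : IsLevyMeasure ν) (ξ : ℝ) :
    Integrable (compensatedExp ξ) ν := by
  refine (hν.integrable_min.const_mul (3 * ξ ^ 2 + 2)).mono'
    (measurable_compensatedExp ξ).aestronglyMeasurable (ae_of_all _ fun y => ?_)
  rcases le_or_gt |y| 1 with hy | hy
  · have h := norm_compensatedExp_le_of_abs_le_one ξ hy
    have : y ^ 2 ≤ 1 := by rw [← sq_abs]; nlinarith [abs_nonneg y]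
    rw [min_eq_right this]
    nlinarith [sq_nonneg y]
  · have h := (norm_compensatedExp_le_of_one_lt_abs ξ hy).trans (min_le_left _ _)
    have : 1 ≤ y ^ 2 := by rw [← sq_abs]; nlinarith [abs_nonneg y]
    rw [min_eq_left this]
    nlinarith [sq_nonneg ξ]

/-- The compensator is linear in `ξ`, so second differences cancel it. What remains is a nonnegative
weight of order `min 1 (y ^ 2)`, which turns a Lévy measure into a finite one. -/
lemma compensatedExp_second_difference (ξ h y : ℝ) :
    2 * compensatedExp ξ y - compensatedExp (ξ + h) y - compensatedExp (ξ - h) y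
      = ((2 - 2 * Real.cos (h * y) : ℝ) : ℂ) * Complex.exp (ξ * y * Complex.I) := by
  unfold compensatedExp
  generalize Set.indicator {x : ℝ | |x| ≤ 1} (fun x => (x : ℂ)) y = u
  have h1 : Complex.exp (Complex.I * ((ξ + h : ℝ) : ℂ) * y)
      = Complex.exp (ξ * y * Complex.I) * Complex.exp (h * y * Complex.I) := by
    rw [← Complex.exp_add]; congr 1; push_cast; ring
  have h2 : Complex.exp (Complex.I * ((ξ - h : ℝ) : ℂ) * y)
      = Complex.exp (ξ * y * Complex.I) * Complex.exp (-(h * y) * Complex.I) := by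
    rw [← Complex.exp_add]; congr 1; push_cast; ring
  have h3 : Complex.exp (Complex.I * ξ * y) = Complex.exp (ξ * y * Complex.I) := by
    congr 1; ring
  rw [h1, h2, h3]
  have h4 := Complex.two_cos (h * y : ℂ)
  push_cast
  rw [h4]
  ring

/-- Second differences of the Lévy symbol do not see the drift. -/
lemma levySymbol_second_difference {ν : Measure ℝ} (hν : IsLevyMeasure ν) (b ξ h : ℝ) :
    2 * levySymbol b ν ξ - levySymbol b ν (ξ + h) - levySymbol b ν (ξ - h)
      = ∫ y, ((2 - 2 * Real.cos (h * y) : ℝ) : ℂ) * Complex.exp (ξ * y * Complex.I) ∂ν := by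
  have hi := integrable_compensatedExp hν
  simp_rw [← compensatedExp_second_difference, levySymbol_eq]
  have h2 : Integrable (fun y => 2 * compensatedExp ξ y) ν := (hi ξ).const_mul 2
  have h3 : Integrable (fun y => 2 * compensatedExp ξ y - compensatedExp (ξ + h) y) ν :=
    h2.sub (hi (ξ + h))
  rw [integral_sub h3 (hi (ξ - h)), integral_sub h2 (hi (ξ + h)), integral_const_mul]
  push_cast
  ring

lemma two_sub_two_cos_nonneg (x : ℝ) : 0 ≤ 2 - 2 * Real.cos x := by
  linarith [Real.cos_le_one x]

lemma two_sub_two_cos_le (h y : ℝ) :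
    2 - 2 * Real.cos (h * y) ≤ (h ^ 2 + 4) * min 1 (y ^ 2) := by
  have h1 := Real.one_sub_sq_div_two_le_cos (x := h * y)
  have h2 := Real.neg_one_le_cos (h * y)
  rcases le_total 1 (y ^ 2) with hy | hy
  · rw [min_eq_left hy]; nlinarith [sq_nonneg h]
  · rw [min_eq_right hy]; nlinarith [sq_nonneg y]

lemma IsLevyMeasure.isFiniteMeasure_withDensity_cos {ν : Measure ℝ} (hν : IsLevyMeasure ν)
    (h : ℝ) :
    IsFiniteMeasure (ν.withDensity fun y => ENNReal.ofReal (2 - 2 * Real.cos (h * y))) := by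
  refine isFiniteMeasure_withDensity_ofReal ?_
  refine Integrable.hasFiniteIntegral ((hν.integrable_min.const_mul (h ^ 2 + 4)).mono'
    (by fun_prop) (ae_of_all _ fun y => ?_))
  rw [Real.norm_of_nonneg (two_sub_two_cos_nonneg _)]
  exact two_sub_two_cos_le h y

lemma charFun_withDensity_cos (ν : Measure ℝ) (h ξ : ℝ) :
    charFun (ν.withDensity fun y => ENNReal.ofReal (2 - 2 * Real.cos (h * y))) ξ
      = ∫ y, ((2 - 2 * Real.cos (h * y) : ℝ) : ℂ) * Complex.exp (ξ * y * Complex.I) ∂ν := by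
  rw [charFun_apply_real, integral_withDensity_eq_integral_toReal_smul (by fun_prop)
    (ae_of_all _ fun _ => ENNReal.ofReal_lt_top)]
  simp only [ENNReal.toReal_ofReal (two_sub_two_cos_nonneg _), Complex.real_smul]

/-- Two measures without atom at the origin agree as soon as their products with the weights
`2 - 2 cos y` and `2 - 2 cos (√2 y)` do. -/
lemma eq_of_withDensity_cos_eq {μ ν : Measure ℝ} (hμ : μ {0} = 0) (hν : ν {0} = 0)
    (H : ∀ h : ℝ, (μ.withDensity fun y => ENNReal.ofReal (2 - 2 * Real.cos (h * y)))
      = ν.withDensity fun y => ENNReal.ofReal (2 - 2 * Real.cos (h * y))) : μ = ν := by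
  -- One weight alone vanishes on a lattice. A common zero `y ≠ 0` of both would make `√2` rational,
  -- so the sum can be inverted off the origin.
  set w : ℝ → ℝ≥0∞ := (fun y => ENNReal.ofReal (2 - 2 * Real.cos (1 * y)))
    + fun y => ENNReal.ofReal (2 - 2 * Real.cos (√2 * y)) with hw
  have hwm : Measurable w := by fun_prop
  have hw0 : ∀ y : ℝ, y ≠ 0 → w y ≠ 0 := by
    intro y hy h0
    have h0 : 2 - 2 * Real.cos (1 * y) ≤ 0 ∧ 2 - 2 * Real.cos (√2 * y) ≤ 0 := by
      simpa [hw, -one_mul] using h0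
    obtain ⟨m, hm⟩ := (Real.cos_eq_one_iff _).1
      (le_antisymm (Real.cos_le_one (1 * y)) (by linarith [h0.1]))
    obtain ⟨n, hn⟩ := (Real.cos_eq_one_iff _).1
      (le_antisymm (Real.cos_le_one (√2 * y)) (by linarith [h0.2]))
    rw [one_mul] at hm
    have hm0 : (m : ℝ) ≠ 0 := by
      rintro h; rw [h, zero_mul] at hm; exact hy hm.symm
    refine irrational_sqrt_two ⟨(n : ℚ) / m, ?_⟩
    push_cast
    rw [div_eq_iff hm0]
    have hpi : (2 * Real.pi) ≠ 0 := by positivity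
    rw [← hm] at hn
    apply mul_right_cancel₀ hpi
    rw [hn]; ring
  have hwtop : ∀ y, w y ≠ ∞ := fun y => by simp [hw]
  have hae : ∀ ρ : Measure ℝ, ρ {0} = 0 → ∀ᵐ y ∂ρ, w y ≠ 0 := by
    intro ρ hρ
    filter_upwards [compl_mem_ae_iff.2 hρ] with y hy using hw0 y hy
  have hE : μ.withDensity w = ν.withDensity w := by
    rw [hw, withDensity_add_left (by fun_prop), withDensity_add_left (by fun_prop), H 1, H √2]
  rw [← withDensity_inv_same hwm (hae μ hμ) (ae_of_all _ hwtop), hE,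
    withDensity_inv_same hwm (hae ν hν) (ae_of_all _ hwtop)]

/-- A small `t > 0` puts `tD` in the strip where `Complex.log` inverts `Complex.exp`. This lifts
identities between characteristic functions to identities between symbols. -/
lemma eq_zero_of_forall_exp_mul_eq_one {D : ℂ}
    (h : ∀ t : ℝ≥0, Complex.exp ((t : ℝ) * D) = 1) : D = 0 := by
  set r : ℝ := (‖D‖ + 1)⁻¹
  have hr : 0 < r := by positivity
  have h1 : |(((r : ℝ) : ℂ) * D).im| < 1 := by
    refine (Complex.abs_im_le_norm _).trans_lt ?_
    rw [norm_mul, Complex.norm_real, Real.norm_of_nonneg hr.le, inv_mul_lt_iff₀ (by positivity)]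
    linarith
  have h2 := h r.toNNReal
  have h3 := Complex.log_exp (x := (r : ℂ) * D)
    (by linarith [(abs_lt.1 h1).1, Real.pi_gt_three]) (by linarith [(abs_lt.1 h1).2, Real.pi_gt_three])
  rw [Real.coe_toNNReal r hr.le] at h2
  rw [h2, Complex.log_one] at h3
  exact (mul_eq_zero.1 h3.symm).resolve_left (by exact_mod_cast hr.ne')

/-! ### Scaling of the symbol and homogeneity of the Lévy measure. -/

section Stable

variable {Ω : Type*} [MeasurableSpace Ω] {P : Measure Ω} {z : ℝ≥0 → Ω → ℝ} {ν : Measure ℝ}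
  {α b : ℝ}

/-- Stability of the process turns into a functional equation for its symbol. -/
lemma exists_levySymbol_scaling (hα : 0 < α) (hm : ∀ t, Measurable (z t))
    (hb : ∀ (t : ℝ≥0) (ξ : ℝ), charFun (P.map (z t)) ξ = Complex.exp ((t : ℝ) * levySymbol b ν ξ))
    (hs : IsStableProcess α z P) {s : ℝ} (hs0 : 0 < s) :
    ∃ c : ℝ, ∀ ξ : ℝ, levySymbol b ν (s * ξ)
      = ((s ^ α : ℝ) : ℂ) * levySymbol b ν ξ - c * ξ * Complex.I := by
  have ha : 0 < s ^ α := by positivity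
  -- Time is scaled by `s ^ α`, so that space is scaled by `s`.
  obtain ⟨c, hc⟩ := hs.scaling (s ^ α).toNNReal (Real.toNNReal_pos.2 ha)
  refine ⟨c, fun ξ => ?_⟩
  have hsα : ((s ^ α).toNNReal : ℝ) ^ (1 / α) = s := by
    rw [Real.coe_toNNReal _ ha.le, ← Real.rpow_mul hs0.le, mul_one_div_cancel hα.ne', Real.rpow_one]
  rw [eq_comm, ← sub_eq_zero]
  refine eq_zero_of_forall_exp_mul_eq_one fun t => ?_
  have h1 := congrArg (fun μ => charFun μ ξ) (hc t)
  simp only [hsα] at h1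
  have hmap : P.map (fun ω => s * z t ω + c * t)
      = (P.map (fun ω => s * z t ω)).map (fun x => x + c * t) := by
    rw [Measure.map_map (by fun_prop) ((hm t).const_mul s)]; rfl
  rw [hmap, charFun_map_add_const, charFun_map_mul_comp (hm t).aemeasurable, hb, hb,
    ← Complex.exp_add] at h1
  have h2 := congrArg (fun u => u / Complex.exp ((t : ℝ) * levySymbol b ν (s * ξ)
    + (inner ℝ (c * (t : ℝ)) ξ : ℝ) * Complex.I)) h1
  simp only [div_self (Complex.exp_ne_zero _), ← Complex.exp_sub] at h2
  rw [← h2]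
  congr 1
  simp only [NNReal.coe_mul, Real.coe_toNNReal _ ha.le, RCLike.inner_apply, conj_trivial]
  push_cast
  ring

lemma map_mul_apply_zero (ν : Measure ℝ) {s : ℝ} (hs0 : 0 < s) (h : ν {0} = 0) :
    ν.map (fun x => s * x) {0} = 0 := by
  rw [Measure.map_apply (by fun_prop) (measurableSet_singleton 0)]
  convert h using 2
  ext x
  simp [ne_of_gt hs0]

/-- The Lévy measure of a stable process is homogeneous. -/
lemma map_mul_eq_of_stable (hα : 0 < α) (hν : IsLevyMeasure ν) (hm : ∀ t, Measurable (z t))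
    (hb : ∀ (t : ℝ≥0) (ξ : ℝ), charFun (P.map (z t)) ξ = Complex.exp ((t : ℝ) * levySymbol b ν ξ))
    (hs : IsStableProcess α z P) {s : ℝ} (hs0 : 0 < s) :
    ν.map (fun x => s * x) = ENNReal.ofReal (s ^ α) • ν := by
  obtain ⟨c, hc⟩ := exists_levySymbol_scaling hα hm hb hs hs0
  refine eq_of_withDensity_cos_eq (map_mul_apply_zero ν hs0 hν.zero) (by simp [hν.zero])
    fun h => ?_
  have hmap : (ν.map (fun x => s * x)).withDensity
        (fun y => ENNReal.ofReal (2 - 2 * Real.cos (h * y)))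
      = (ν.withDensity fun y => ENNReal.ofReal (2 - 2 * Real.cos ((s * h) * y))).map
        (fun x => s * x) := by
    ext A hA
    rw [withDensity_apply _ hA, Measure.map_apply (by fun_prop) hA,
      withDensity_apply _ (hA.preimage (by fun_prop)),
      setLIntegral_map hA (by fun_prop) (by fun_prop)]
    congr 1 with x
    congr 4
    ring
  have := hν.isFiniteMeasure_withDensity_cos h
  have := hν.isFiniteMeasure_withDensity_cos (s * h)
  rw [hmap, withDensity_smul_measure]
  have hfin : IsFiniteMeasure (ENNReal.ofReal (s ^ α) •
      ν.withDensity fun y => ENNReal.ofReal (2 - 2 * Real.cos (h * y))) :=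
    Measure.smul_finite _ ENNReal.ofReal_ne_top
  -- The left side is the second difference of the symbol at `sξ` with step `sh`; the scaling
  -- relation applies to its three terms and the contributions of `c` cancel.
  refine Measure.ext_of_charFun (funext fun ξ => ?_)
  rw [charFun_map_mul, charFun_withDensity_cos, ← levySymbol_second_difference hν b,
    charFun_apply_real, integral_smul_measure, ← charFun_apply_real, charFun_withDensity_cos,
    ← levySymbol_second_difference hν b, ← mul_add, ← mul_sub, hc, hc, hc,
    ENNReal.toReal_ofReal (by positivity), Complex.real_smul]
  push_cast
  ring

/-- Without jumps only the drift remains, and `z 1` would be constant. -/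
lemma ne_zero_of_stable [IsProbabilityMeasure P] (hm : Measurable (z 1))
    (hb : ∀ (t : ℝ≥0) (ξ : ℝ), charFun (P.map (z t)) ξ = Complex.exp ((t : ℝ) * levySymbol b ν ξ))
    (hs : IsStableProcess α z P) : ν ≠ 0 := by
  rintro rfl
  refine hs.nondegenerate ⟨b, ?_⟩
  have := Measure.isProbabilityMeasure_map (μ := P) hm.aemeasurable
  refine Measure.ext_of_charFun (funext fun ξ => ?_)
  rw [hb, charFun_dirac]
  congr 1
  simp [levySymbol]
  ring

end Stable

/-! ### Pareto densities and the L¹ distance of their translates. -/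

section Pareto

variable {K α : ℝ}

lemma integrableOn_rpow_Ici (hK : 0 < K) {a : ℝ} (ha : a < -1) :
    IntegrableOn (fun x : ℝ => x ^ a) (Set.Ici K) :=
  (integrableOn_Ici_iff_integrableOn_Ioi (by finiteness)).2 (integrableOn_Ioi_rpow_of_lt ha hK)

lemma paretoPDFReal_eq_indicator (K α : ℝ) :
    paretoPDFReal K α = (Set.Ici K).indicator fun x => α * K ^ α * x ^ (-(α + 1)) := by
  ext x
  simp [paretoPDFReal, Set.indicator_apply]

lemma integrable_paretoPDFReal (hK : 0 < K) (hα : 0 < α) : Integrable (paretoPDFReal K α) := by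
  rw [paretoPDFReal_eq_indicator, integrable_indicator_iff measurableSet_Ici]
  exact (integrableOn_rpow_Ici hK (by linarith)).const_mul _

lemma setIntegral_paretoPDFReal_Ici (hK : 0 < K) (hα : 0 < α) {a : ℝ} (ha : K ≤ a) :
    ∫ x in Set.Ici a, paretoPDFReal K α x = (K / a) ^ α := by
  have ha0 : 0 < a := hK.trans_le ha
  have h : ∀ x ∈ Set.Ici a, paretoPDFReal K α x = α * K ^ α * x ^ (-(α + 1)) := fun x hx => by
    rw [paretoPDFReal, if_pos (ha.trans hx)]
  rw [setIntegral_congr_fun measurableSet_Ici h, integral_Ici_eq_integral_Ioi, integral_const_mul,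
    integral_Ioi_rpow_of_lt (by linarith) ha0, Real.div_rpow hK.le ha0.le]
  have : -(α + 1) + 1 = -α := by ring
  rw [this, Real.rpow_neg ha0.le]
  field_simp

lemma paretoMeasure_apply_Ici (hK : 0 < K) (hα : 0 < α) {a : ℝ} (ha : K ≤ a) :
    paretoMeasure K α (Set.Ici a) = ENNReal.ofReal ((K / a) ^ α) := by
  rw [paretoMeasure, withDensity_apply _ measurableSet_Ici, ← setIntegral_paretoPDFReal_Ici hK hα ha,
    ofReal_integral_eq_lintegral_ofReal (integrable_paretoPDFReal hK hα).integrableOn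
      (ae_of_all _ fun x => paretoPDFReal_nonneg hK.le hα.le x)]
  rfl

lemma antitoneOn_paretoPDFReal (hK : 0 < K) (hα : 0 < α) :
    AntitoneOn (paretoPDFReal K α) (Set.Ici K) := by
  intro x hx y hy hxy
  rw [paretoPDFReal, paretoPDFReal, if_pos (Set.mem_Ici.1 hx), if_pos (Set.mem_Ici.1 hy)]
  have := Real.rpow_le_rpow_of_nonpos (hK.trans_le hx) hxy (show -(α + 1) ≤ 0 by linarith)
  gcongr

/-- The `L¹` distance between a density that decreases on `[K, ∞)` and vanishes on `(-∞, K)` and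
its translate. -/
lemma integral_abs_translate_sub {q : ℝ → ℝ} (hq : Integrable q) (hq0 : ∀ x, 0 ≤ q x)
    (hqK : ∀ x < K, q x = 0) (hanti : AntitoneOn q (Set.Ici K)) {h : ℝ} (hh : 0 ≤ h) :
    ∫ x, |q (x - h) - q x| = 2 * ∫ x in Set.Ico K (K + h), q x := by
  -- The difference is negative at most on `[K, K + h)`, where the translate still vanishes;
  -- monotonicity makes it nonnegative further right. Its signed integral is zero, so twice the
  -- negative part is left.
  have key : ∀ x, |q (x - h) - q x|
      = (q (x - h) - q x) + 2 * (Set.Ico K (K + h)).indicator q x := by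
    intro x
    rcases lt_or_ge x K with hx | hx
    · rw [hqK x hx, hqK (x - h) (by linarith), Set.indicator_of_notMem (fun hm => not_le.2 hx hm.1)]
      simp
    rcases lt_or_ge x (K + h) with hx' | hx'
    · rw [hqK (x - h) (by linarith), Set.indicator_of_mem (Set.mem_Ico.2 ⟨hx, hx'⟩), zero_sub, abs_neg,
        abs_of_nonneg (hq0 x)]
      ring
    · rw [Set.indicator_of_notMem (fun hm => not_le.2 hm.2 hx'), abs_of_nonneg, mul_zero, add_zero]
      exact sub_nonneg.2 (hanti (by simpa using by linarith) hx (by linarith))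
  have h1 : Integrable fun x => q (x - h) := hq.comp_sub_right h
  have h2 : Integrable fun x => q (x - h) - q x := h1.sub hq
  have h3 : Integrable fun x => 2 * (Set.Ico K (K + h)).indicator q x :=
    (hq.indicator measurableSet_Ico).const_mul 2
  simp_rw [key]
  rw [integral_add h2 h3, integral_sub h1 hq, integral_sub_right_eq_self q h, sub_self, zero_add,
    integral_const_mul, integral_indicator measurableSet_Ico]

lemma integral_abs_translate_sub_translate (q : ℝ → ℝ) (a b : ℝ) :
    ∫ x, |q (x - a) - q (x - b)| = ∫ x, |q (x - |a - b|) - q x| := by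
  have aux : ∀ a b : ℝ, b ≤ a →
      ∫ x, |q (x - a) - q (x - b)| = ∫ x, |q (x - |a - b|) - q x| := by
    intro a b hab
    rw [abs_of_nonneg (sub_nonneg.2 hab),
      ← integral_sub_right_eq_self (fun x => |q (x - (a - b)) - q x|) b]
    congr with x
    congr 3
    ring
  rcases le_total b a with h | h
  · exact aux a b h
  · rw [abs_sub_comm a b, ← aux b a h]
    simp_rw [abs_sub_comm]

lemma integral_abs_paretoPDFReal_sub (hK : 0 < K) (hα : 0 < α) (a b : ℝ) :
    ∫ x, |paretoPDFReal K α (x - a) - paretoPDFReal K α (x - b)|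
      = 2 * ∫ x in Set.Ico K (K + |a - b|), paretoPDFReal K α x := by
  rw [integral_abs_translate_sub_translate]
  exact integral_abs_translate_sub (integrable_paretoPDFReal hK hα)
    (paretoPDFReal_nonneg hK.le hα.le) (fun x hx => if_neg (not_le.2 hx))
    (antitoneOn_paretoPDFReal hK hα) (abs_nonneg _)

/-- The density is largest at `K`, where it equals `α / K`. -/
lemma integral_abs_paretoPDFReal_sub_le (hK : 0 < K) (hα : 0 < α) (a b : ℝ) :
    ∫ x, |paretoPDFReal K α (x - a) - paretoPDFReal K α (x - b)| ≤ 2 * α / K * |a - b| := by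
  have hqK : paretoPDFReal K α K = α / K := by
    rw [paretoPDFReal, if_pos le_rfl, mul_assoc, ← Real.rpow_add hK]
    have : α + -(α + 1) = -1 := by ring
    rw [this, Real.rpow_neg_one, div_eq_mul_inv]
  have h : ∫ x in Set.Ico K (K + |a - b|), paretoPDFReal K α x ≤ α / K * |a - b| := by
    calc ∫ x in Set.Ico K (K + |a - b|), paretoPDFReal K α x
        ≤ ∫ _ in Set.Ico K (K + |a - b|), α / K :=
          setIntegral_mono_on (integrable_paretoPDFReal hK hα).integrableOn
            (integrableOn_const (by simp)) measurableSet_Ico fun x hx =>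
              hqK ▸ antitoneOn_paretoPDFReal hK hα (Set.mem_Ici.2 le_rfl) hx.1 hx.1
      _ = α / K * |a - b| := by
          simp [mul_comm]
  rw [integral_abs_paretoPDFReal_sub hK hα]
  calc _ ≤ 2 * (α / K * |a - b|) := by gcongr
    _ = _ := by ring

/-- The exact value shows that the distance depends only on `|a - b|`, increases with it and stays
below `2`. -/
lemma integral_abs_paretoPDFReal_sub_eq (hK : 0 < K) (hα : 0 < α) (a b : ℝ) :
    ∫ x, |paretoPDFReal K α (x - a) - paretoPDFReal K α (x - b)|
      = 2 * (1 - (K / (K + |a - b|)) ^ α) := by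
  have hq := integrable_paretoPDFReal hK hα
  have h : (∫ x in Set.Ico K (K + |a - b|), paretoPDFReal K α x)
      + ∫ x in Set.Ici (K + |a - b|), paretoPDFReal K α x = ∫ x in Set.Ici K, paretoPDFReal K α x := by
    have hle : K ≤ K + |a - b| := by linarith [abs_nonneg (a - b)]
    rw [← Set.Ico_union_Ici_eq_Ici hle, setIntegral_union _ measurableSet_Ici hq.integrableOn
      hq.integrableOn]
    exact Set.disjoint_left.2 fun x hx hx' => not_le.2 hx.2 hx'
  rw [setIntegral_paretoPDFReal_Ici hK hα (by linarith [abs_nonneg (a - b)]),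
    setIntegral_paretoPDFReal_Ici hK hα le_rfl, div_self hK.ne', Real.one_rpow] at h
  rw [integral_abs_paretoPDFReal_sub hK hα]
  linarith

lemma integrable_abs_rpow_paretoMeasure (hK : 0 < K) {β : ℝ} (hα : 0 < α) (hβ : β < α) :
    Integrable (fun x => |x| ^ β) (paretoMeasure K α) := by
  rw [paretoMeasure, integrable_withDensity_iff (f := paretoPDF K α) (by unfold paretoPDF; fun_prop)
    (ae_of_all _ fun _ => ENNReal.ofReal_lt_top)]
  have : (fun x => |x| ^ β * (paretoPDF K α x).toReal)
      = (Set.Ici K).indicator fun x => α * K ^ α * x ^ (β - (α + 1)) := by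
    ext x
    rw [paretoPDF, ENNReal.toReal_ofReal (paretoPDFReal_nonneg hK.le hα.le x),
      paretoPDFReal_eq_indicator]
    by_cases hx : x ∈ Set.Ici K
    · have hx0 : 0 < x := hK.trans_le hx
      rw [Set.indicator_of_mem hx, Set.indicator_of_mem hx, abs_of_pos hx0, sub_eq_add_neg,
        Real.rpow_add hx0]
      ring
    · rw [Set.indicator_of_notMem hx, Set.indicator_of_notMem hx, mul_zero]
  rw [this, integrable_indicator_iff measurableSet_Ici]
  exact (integrableOn_rpow_Ici hK (by linarith)).const_mul _

end Pareto

/-! ### Homogeneous Lévy measures and the law of their big jumps. -/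

section Homogeneous

variable {μ ν : Measure ℝ} {K α : ℝ}

/-- Multiplication by `K / a` carries `[a, ∞)` onto `[K, ∞)`. -/
lemma apply_Ici_of_homogeneous
    (hom : ∀ s : ℝ, 0 < s → μ.map (fun x => s * x) = ENNReal.ofReal (s ^ α) • μ)
    (hK : 0 < K) {a : ℝ} (ha : 0 < a) :
    μ (Set.Ici a) = ENNReal.ofReal ((K / a) ^ α) * μ (Set.Ici K) := by
  have h := congrArg (fun ρ => ρ (Set.Ici K)) (hom (K / a) (by positivity))
  simp only [Measure.smul_apply, smul_eq_mul] at h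
  rw [← h, Measure.map_apply (by fun_prop) measurableSet_Ici]
  congr 1
  ext x
  rw [Set.mem_Ici, Set.mem_preimage, Set.mem_Ici, div_mul_eq_mul_div, le_div_iff₀ ha,
    mul_le_mul_iff_right₀ hK]

/-- A homogeneous measure on the half-line is a multiple of a Pareto distribution. -/
lemma restrict_Ici_of_homogeneous (hα : 0 < α)
    (hom : ∀ s : ℝ, 0 < s → μ.map (fun x => s * x) = ENNReal.ofReal (s ^ α) • μ)
    (hK : 0 < K) (hfin : μ (Set.Ici K) ≠ ∞) :
    μ.restrict (Set.Ici K) = μ (Set.Ici K) • paretoMeasure K α := by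
  have : IsFiniteMeasure (μ.restrict (Set.Ici K)) := ⟨by simpa using hfin.lt_top⟩
  have := isProbabilityMeasure_paretoMeasure hK hα
  have hpK : paretoMeasure K α (Set.Ici K) = 1 := by
    rw [paretoMeasure_apply_Ici hK hα le_rfl, div_self hK.ne', Real.one_rpow, ENNReal.ofReal_one]
  -- Finite measures are determined by the half-lines `[a, ∞)`; for `a ≤ K` both sides have already
  -- reached their total mass.
  refine Measure.ext_of_Ici _ _ fun a => ?_
  rw [Measure.restrict_apply measurableSet_Ici, Measure.smul_apply, smul_eq_mul]
  rcases le_total a K with h | h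
  · have : paretoMeasure K α (Set.Ici a) = 1 :=
      le_antisymm prob_le_one (hpK ▸ measure_mono (Set.Ici_subset_Ici.2 h))
    rw [Set.inter_eq_right.2 (Set.Ici_subset_Ici.2 h), this, mul_one]
  · rw [Set.inter_eq_left.2 (Set.Ici_subset_Ici.2 h), paretoMeasure_apply_Ici hK hα h, mul_comm,
      apply_Ici_of_homogeneous hom hK (hK.trans_le h)]

lemma homogeneous_map_neg
    (hom : ∀ s : ℝ, 0 < s → μ.map (fun x => s * x) = ENNReal.ofReal (s ^ α) • μ)
    (s : ℝ) (hs : 0 < s) :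
    (μ.map Neg.neg).map (fun x => s * x) = ENNReal.ofReal (s ^ α) • μ.map Neg.neg := by
  rw [← Measure.map_smul, ← hom s hs, Measure.map_map (by fun_prop) measurable_neg,
    Measure.map_map measurable_neg (by fun_prop)]
  congr 1
  ext x
  simp

lemma measurableSet_bigJumps (K : ℝ) : MeasurableSet (bigJumps K) :=
  measurableSet_Iic.union measurableSet_Ici

lemma mem_bigJumps {K x : ℝ} : x ∈ bigJumps K ↔ K ≤ |x| := by
  rw [bigJumps, Set.mem_union, Set.mem_Iic, Set.mem_Ici, le_abs, or_comm, le_neg]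

/-- Markov's inequality for `min 1 (y ^ 2)`. -/
lemma IsLevyMeasure.apply_bigJumps_ne_top (hν : IsLevyMeasure ν) (hK : 0 < K) :
    ν (bigJumps K) ≠ ∞ := by
  have h : bigJumps K ⊆ {y | ENNReal.ofReal (min 1 (K ^ 2)) ≤ ENNReal.ofReal (min 1 (y ^ 2))} := by
    intro y hy
    have : K ^ 2 ≤ y ^ 2 := by
      rw [← sq_abs y]
      have := mem_bigJumps.1 hy
      gcongr
    exact ENNReal.ofReal_le_ofReal (min_le_min le_rfl this)
  refine ((measure_mono h).trans_lt ?_).ne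
  exact (meas_ge_le_lintegral_div (by fun_prop) (by simpa using by positivity)
    ENNReal.ofReal_ne_top).trans_lt
      (ENNReal.div_lt_top hν.lintegral_lt_top.ne (by simpa using by positivity))

lemma apply_bigJumps_of_homogeneous
    (hom : ∀ s : ℝ, 0 < s → μ.map (fun x => s * x) = ENNReal.ofReal (s ^ α) • μ)
    (hK : 0 < K) : μ (bigJumps K) = ENNReal.ofReal ((K⁻¹) ^ α) * μ (bigJumps 1) := by
  have h := congrArg (fun ρ => ρ (bigJumps 1)) (hom K⁻¹ (by positivity))
  simp only [Measure.smul_apply, smul_eq_mul] at h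
  rw [← h, Measure.map_apply (by fun_prop) (measurableSet_bigJumps 1)]
  congr 1
  ext x
  rw [Set.mem_preimage, mem_bigJumps, mem_bigJumps, abs_mul, abs_of_pos (inv_pos.2 hK),
    inv_mul_eq_div, one_le_div hK]

/-- If there were no jumps of size at least `1`, homogeneity would exclude those of size at least `1
/ (n + 1)` for every `n`, and these sets exhaust the punctured line. -/
lemma apply_bigJumps_ne_zero (hν : IsLevyMeasure ν) (hne : ν ≠ 0)
    (hom : ∀ s : ℝ, 0 < s → ν.map (fun x => s * x) = ENNReal.ofReal (s ^ α) • ν)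
    (hK : 0 < K) : ν (bigJumps K) ≠ 0 := by
  have h1 : ν (bigJumps 1) ≠ 0 := by
    intro h1
    refine hne (Measure.measure_univ_eq_zero.1 ?_)
    have hsub : (Set.univ : Set ℝ) ⊆ {0} ∪ ⋃ n : ℕ, bigJumps (1 / ((n : ℝ) + 1)) := by
      intro x _
      rcases eq_or_ne x 0 with rfl | hx
      · exact Or.inl rfl
      · obtain ⟨n, hn⟩ := exists_nat_one_div_lt (abs_pos.2 hx)
        exact Or.inr (Set.mem_iUnion.2 ⟨n, mem_bigJumps.2 hn.le⟩)
    refine measure_mono_null hsub (measure_union_null hν.zero (measure_iUnion_null fun n => ?_))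
    rw [apply_bigJumps_of_homogeneous hom (by positivity), h1, mul_zero]
  rw [apply_bigJumps_of_homogeneous hom hK]
  refine mul_ne_zero ?_ h1
  simpa using by positivity

/-- The big jumps of a homogeneous measure follow a Pareto law on each side of the origin. -/
lemma restrict_bigJumps_of_homogeneous (hα : 0 < α) (hν : IsLevyMeasure ν)
    (hom : ∀ s : ℝ, 0 < s → ν.map (fun x => s * x) = ENNReal.ofReal (s ^ α) • ν)
    (hK : 0 < K) :
    ν.restrict (bigJumps K) = ν (Set.Iic (-K)) • (paretoMeasure K α).map Neg.neg
      + ν (Set.Ici K) • paretoMeasure K α := by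
  have hfin := hν.apply_bigJumps_ne_top hK
  have hpre : (Neg.neg ⁻¹' Set.Ici K : Set ℝ) = Set.Iic (-K) := by
    ext x; simp
  have hmap : ν.map Neg.neg (Set.Ici K) = ν (Set.Iic (-K)) := by
    rw [Measure.map_apply measurable_neg measurableSet_Ici, hpre]
  have h1 := restrict_Ici_of_homogeneous hα hom hK
    (ne_top_of_le_ne_top hfin (measure_mono Set.subset_union_right))
  -- The negative jumps are treated as positive jumps of the reflected measure, and reflected back
  -- in `h3`.
  have h2 := restrict_Ici_of_homogeneous hα (homogeneous_map_neg hom) hK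
    (hmap ▸ ne_top_of_le_ne_top hfin (measure_mono Set.subset_union_left))
  rw [hmap, Measure.restrict_map measurable_neg measurableSet_Ici, hpre] at h2
  have h3 := congrArg (Measure.map Neg.neg) h2
  rw [Measure.map_map measurable_neg measurable_neg, neg_comp_neg, Measure.map_id,
    Measure.map_smul] at h3
  rw [bigJumps, Measure.restrict_union _ measurableSet_Ici, h1, h3]
  refine Set.disjoint_left.2 fun x hx hx' => ?_
  rw [Set.mem_Iic] at hx
  rw [Set.mem_Ici] at hx'
  linarith

lemma integrableOn_abs_rpow_bigJumps (hα : 0 < α) (hν : IsLevyMeasure ν)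
    (hom : ∀ s : ℝ, 0 < s → ν.map (fun x => s * x) = ENNReal.ofReal (s ^ α) • ν)
    (hK : 0 < K) {β : ℝ} (hβ : β < α) :
    IntegrableOn (fun x => |x| ^ β) (bigJumps K) ν := by
  have hfin := hν.apply_bigJumps_ne_top hK
  have hi := integrable_abs_rpow_paretoMeasure hK hα hβ
  rw [IntegrableOn, restrict_bigJumps_of_homogeneous hα hν hom hK]
  refine Integrable.add_measure (Integrable.smul_measure ?_
    (ne_top_of_le_ne_top hfin (measure_mono Set.subset_union_left))) (hi.smul_measure
    (ne_top_of_le_ne_top hfin (measure_mono Set.subset_union_right)))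
  have hmeas : Measurable fun x : ℝ => |x| ^ β := measurable_id.abs.pow_const β
  rw [integrable_map_measure hmeas.aestronglyMeasurable (by fun_prop)]
  simpa [Function.comp_def] using hi

/-- The density of the normalised law of the big jumps: a mixture of a Pareto density and a
reflected one. -/
noncomputable def jumpDensity (ν : Measure ℝ) (α K x : ℝ) : ℝ :=
  (ν (Set.Iic (-K)) / ν (bigJumps K)).toReal * paretoPDFReal K α (-x)
    + (ν (Set.Ici K) / ν (bigJumps K)).toReal * paretoPDFReal K α x

lemma map_neg_paretoMeasure (K α : ℝ) :
    (paretoMeasure K α).map Neg.neg = volume.withDensity fun x => paretoPDF K α (-x) := by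
  ext A hA
  rw [Measure.map_apply measurable_neg hA, paretoMeasure,
    withDensity_apply _ (hA.preimage measurable_neg), withDensity_apply _ hA]
  conv_rhs => rw [← Measure.map_neg_eq_self (volume : Measure ℝ)]
  rw [setLIntegral_map hA (by unfold paretoPDF; fun_prop) measurable_neg]
  simp

lemma isDensity_jumpDensity (hα : 0 < α) (hν : IsLevyMeasure ν) (hne : ν ≠ 0)
    (hom : ∀ s : ℝ, 0 < s → ν.map (fun x => s * x) = ENNReal.ofReal (s ^ α) • ν)
    (hK : 0 < K) : IsDensity (jumpDensity ν α K) (jumpLaw ν K) := by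
  have hfin := hν.apply_bigJumps_ne_top hK
  have h0 := apply_bigJumps_ne_zero hν hne hom hK
  have hq := paretoPDFReal_nonneg hK.le hα.le
  refine ⟨by unfold jumpDensity; fun_prop, fun x => ?_, ?_⟩
  · unfold jumpDensity
    have := hq x
    have := hq (-x)
    positivity
  · rw [jumpLaw, restrict_bigJumps_of_homogeneous hα hν hom hK, map_neg_paretoMeasure,
      paretoMeasure, smul_add, smul_smul, smul_smul,
      ← withDensity_smul _ (by unfold paretoPDF; fun_prop),
      ← withDensity_smul _ (by unfold paretoPDF; fun_prop),
      ← withDensity_add_left (by unfold paretoPDF; fun_prop)]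
    congr 1
    ext x
    have hne1 : ν (Set.Iic (-K)) / ν (bigJumps K) ≠ ∞ :=
      ENNReal.div_ne_top (ne_top_of_le_ne_top hfin (measure_mono Set.subset_union_left)) h0
    have hne2 : ν (Set.Ici K) / ν (bigJumps K) ≠ ∞ :=
      ENNReal.div_ne_top (ne_top_of_le_ne_top hfin (measure_mono Set.subset_union_right)) h0
    have := hq x
    have := hq (-x)
    rw [jumpDensity, ENNReal.ofReal_add (by positivity) (by positivity),
      ENNReal.ofReal_mul (by positivity), ENNReal.ofReal_mul (by positivity),
      ENNReal.ofReal_toReal hne1, ENNReal.ofReal_toReal hne2]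
    simp only [Pi.add_apply, Pi.smul_apply, smul_eq_mul, paretoPDF, div_eq_mul_inv, mul_comm]

lemma jumpDensity_weights_add (hν : IsLevyMeasure ν) (hK : 0 < K) (h0 : ν (bigJumps K) ≠ 0) :
    (ν (Set.Iic (-K)) / ν (bigJumps K)).toReal + (ν (Set.Ici K) / ν (bigJumps K)).toReal = 1 := by
  have hfin := hν.apply_bigJumps_ne_top hK
  rw [← ENNReal.toReal_add
      (ENNReal.div_ne_top (ne_top_of_le_ne_top hfin (measure_mono Set.subset_union_left)) h0)
      (ENNReal.div_ne_top (ne_top_of_le_ne_top hfin (measure_mono Set.subset_union_right)) h0),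
    ← ENNReal.add_div, ← measure_union _ measurableSet_Ici, ← bigJumps, ENNReal.div_self h0 hfin,
    ENNReal.toReal_one]
  refine Set.disjoint_left.2 fun x hx hx' => ?_
  rw [Set.mem_Iic] at hx
  rw [Set.mem_Ici] at hx'
  linarith

/-- Translates of the jump density are at most as far apart as those of the Pareto density. -/
lemma integral_abs_jumpDensity_sub_le (hα : 0 < α) (hν : IsLevyMeasure ν) (hK : 0 < K)
    (h0 : ν (bigJumps K) ≠ 0) (a b : ℝ) :
    ∫ x, |jumpDensity ν α K (x - a) - jumpDensity ν α K (x - b)|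
      ≤ ∫ x, |paretoPDFReal K α (x - a) - paretoPDFReal K α (x - b)| := by
  have hw := jumpDensity_weights_add hν hK h0
  set u := (ν (Set.Iic (-K)) / ν (bigJumps K)).toReal with hu
  set v := (ν (Set.Ici K) / ν (bigJumps K)).toReal with hv
  have hu0 : 0 ≤ u := ENNReal.toReal_nonneg
  have hv0 : 0 ≤ v := ENNReal.toReal_nonneg
  set q := paretoPDFReal K α with hqdef
  have hq : Integrable q := integrable_paretoPDFReal hK hα
  have hr : Integrable fun x => |q (x - a) - q (x - b)| :=
    ((hq.comp_sub_right a).sub (hq.comp_sub_right b)).abs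
  have hn : Integrable fun x => q (-x) := hq.comp_neg
  have hl : Integrable fun x => |q (-(x - a)) - q (-(x - b))| :=
    ((hn.comp_sub_right a).sub (hn.comp_sub_right b)).abs
  -- Reflection turns shifts by `a`, `b` into shifts by `-a`, `-b`, which are equally far apart.
  have hle : ∫ x, |q (-(x - a)) - q (-(x - b))| = ∫ x, |q (x - a) - q (x - b)| := by
    have : ∀ x : ℝ, |q (-(-x - a)) - q (-(-x - b))| = |q (x - (-a)) - q (x - (-b))| := by
      intro x; congr 3 <;> ring
    rw [← integral_neg_eq_self]
    simp_rw [this]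
    rw [hqdef, integral_abs_paretoPDFReal_sub_eq hK hα, integral_abs_paretoPDFReal_sub_eq hK hα,
      neg_sub_neg, abs_sub_comm]
  calc ∫ x, |jumpDensity ν α K (x - a) - jumpDensity ν α K (x - b)|
      ≤ ∫ x, (u * |q (-(x - a)) - q (-(x - b))| + v * |q (x - a) - q (x - b)|) := by
        refine integral_mono_of_nonneg (ae_of_all _ fun x => abs_nonneg _)
          ((hl.const_mul u).add (hr.const_mul v)) (ae_of_all _ fun x => ?_)
        have : jumpDensity ν α K (x - a) - jumpDensity ν α K (x - b)
            = u * (q (-(x - a)) - q (-(x - b))) + v * (q (x - a) - q (x - b)) := by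
          simp only [jumpDensity, ← hu, ← hv, ← hqdef]; ring
        simp only [this]
        refine (abs_add_le _ _).trans ?_
        rw [abs_mul, abs_mul, abs_of_nonneg hu0, abs_of_nonneg hv0]
    _ = (u + v) * ∫ x, |q (x - a) - q (x - b)| := by
        rw [integral_add (hl.const_mul u) (hr.const_mul v), integral_const_mul, integral_const_mul,
          hle, add_mul]
    _ = _ := by rw [hw, one_mul]

end Homogeneous

/-! ### Pathwise convergence of left-endpoint sums. -/

/-- Right continuity and the left limit bound the path near each point; compactness of `[0, t]` does
the rest. The bound serves as a dominating constant. -/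
lemma IsCadlagPath.exists_bound {x : ℝ≥0 → ℝ} (hx : IsCadlagPath x) (t : ℝ≥0) :
    ∃ C : ℝ, ∀ r ≤ t, |x r| ≤ C := by
  have hc : IsCompact (Set.Iic t) := by
    rw [← Set.Icc_bot]; exact isCompact_Icc
  refine hc.induction_on (p := fun s => ∃ C : ℝ, ∀ r ∈ s, |x r| ≤ C) ⟨0, by simp⟩
    (fun s s' hss ⟨C, hC⟩ => ⟨C, fun r hr => hC r (hss hr)⟩) ?_ ?_
  · rintro s s' ⟨C, hC⟩ ⟨C', hC'⟩
    refine ⟨max C C', ?_⟩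
    rintro r (hr | hr)
    · exact (hC r hr).trans (le_max_left _ _)
    · exact (hC' r hr).trans (le_max_right _ _)
  · intro r _
    obtain ⟨h1, l, h2⟩ := hx r
    have e1 : ∀ᶠ u in 𝓝[≥] r, |x u| < |x r| + 1 := h1.abs.eventually_lt_const (by linarith)
    have e2 : ∀ᶠ u in 𝓝[<] r, |x u| < |l| + 1 := h2.abs.eventually_lt_const (by linarith)
    refine ⟨{u | |x u| ≤ max (|x r| + 1) (|l| + 1)}, ?_, _, fun u hu => hu⟩
    refine mem_nhdsWithin_of_mem_nhds ?_
    rw [← nhdsLT_sup_nhdsGE]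
    refine mem_sup.2 ⟨?_, ?_⟩
    · filter_upwards [e2] with u hu using hu.le.trans (le_max_right _ _)
    · filter_upwards [e1] with u hu using hu.le.trans (le_max_left _ _)

/-- The first point of the sequence `s` that is at least `r`. -/
noncomputable def nextPoint (s : ℕ → ℝ≥0) (r : ℝ) : ℝ≥0 := s (sInf {j | r ≤ s j})

lemma nextPoint_eq {s : ℕ → ℝ≥0} (hs : Monotone s) {i : ℕ} {r : ℝ}
    (hr : r ∈ Set.Ioc (s i : ℝ) (s (i + 1))) : nextPoint s r = s (i + 1) := by
  have : sInf {j | r ≤ s j} = i + 1 := by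
    refine le_antisymm (Nat.sInf_le hr.2) (le_csInf ⟨_, hr.2⟩ fun j hj => ?_)
    by_contra! hlt
    have h1 : (s j : ℝ) ≤ s i := by exact_mod_cast hs (Nat.lt_succ_iff.1 hlt)
    exact absurd hr.1 (not_lt.2 (le_trans hj h1))
  rw [nextPoint, this]

lemma exists_mem_Ioc {s : ℕ → ℝ≥0} (hs0 : s 0 = 0) {k : ℕ} {r : ℝ} (hr0 : 0 < r)
    (hr : r ≤ s k) : ∃ i < k, r ∈ Set.Ioc (s i : ℝ) (s (i + 1)) := by
  induction k with
  | zero => rw [hs0] at hr; exact absurd hr0 (not_lt.2 (by simpa using hr))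
  | succ k ih =>
    rcases le_or_gt r (s k) with h | h
    · obtain ⟨i, hi, h⟩ := ih h
      exact ⟨i, by omega, h⟩
    · exact ⟨k, by omega, h, hr⟩

/-- Abel summation for a left-endpoint sum. -/
lemma sum_mul_sub_eq (f x : ℕ → ℝ) (k : ℕ) :
    ∑ i ∈ Finset.range k, f i * (x (i + 1) - x i)
      = f k * x k - f 0 * x 0 - ∑ i ∈ Finset.range k, x (i + 1) * (f (i + 1) - f i) := by
  induction k with
  | zero => simp
  | succ k ih => rw [Finset.sum_range_succ, Finset.sum_range_succ, ih]; ring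

section Path

variable {f f' : ℝ → ℝ} {x : ℝ≥0 → ℝ}

lemma intervalIntegrable_nextPoint (hf' : Continuous f') {s : ℕ → ℝ≥0} (hs : Monotone s) (i : ℕ) :
    IntervalIntegrable (fun r => x (nextPoint s r) * f' r) volume (s i) (s (i + 1)) := by
  have hc : IntervalIntegrable (fun r => x (s (i + 1)) * f' r) volume (s i) (s (i + 1)) :=
    (hf'.intervalIntegrable _ _).const_mul _
  refine hc.congr fun r hr => ?_
  rw [Set.uIoc_of_le (by exact_mod_cast hs (Nat.le_succ i))] at hr
  simp only [nextPoint_eq hs hr]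

lemma integral_nextPoint (hf : ∀ r, HasDerivAt f (f' r) r) (hf' : Continuous f') {s : ℕ → ℝ≥0}
    (hs : Monotone s) (i : ℕ) :
    ∫ r in (s i : ℝ)..s (i + 1), x (nextPoint s r) * f' r
      = x (s (i + 1)) * (f (s (i + 1)) - f (s i)) := by
  have hle : (s i : ℝ) ≤ s (i + 1) := by exact_mod_cast hs (Nat.le_succ i)
  rw [← intervalIntegral.integral_eq_sub_of_hasDerivAt (fun r _ => hf r)
    (hf'.intervalIntegrable _ _), ← intervalIntegral.integral_const_mul]
  refine intervalIntegral.integral_congr_ae (ae_of_all _ fun r hr => ?_)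
  rw [Set.uIoc_of_le hle] at hr
  rw [nextPoint_eq hs hr]

/-- Left-endpoint sums of a continuously differentiable integrand against a càdlàg path converge,
and the limit is given by integration by parts. -/
lemma tendsto_sum_mul_increments (hf : ∀ r, HasDerivAt f (f' r) r) (hf' : Continuous f')
    (hx : IsCadlagPath x) {t : ℝ≥0} {k : ℕ → ℕ} {s : ℕ → ℕ → ℝ≥0} (hs : ∀ n, Monotone (s n))
    (hs0 : ∀ n, s n 0 = 0) (hst : ∀ n, s n (k n) = t)
    (hmesh : ∀ ε : ℝ, 0 < ε → ∀ᶠ n in atTop, ∀ i < k n, (s n (i + 1) : ℝ) - s n i ≤ ε) :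
    Tendsto (fun n => ∑ i ∈ Finset.range (k n), f (s n i) * (x (s n (i + 1)) - x (s n i))) atTop
      (𝓝 (f t * x t - f 0 * x 0 - ∫ r in (0 : ℝ)..t, x r.toNNReal * f' r)) := by
  obtain ⟨C, hC⟩ := hx.exists_bound t
  -- Abel summation moves the increments onto `f` and evaluates the path at right endpoints, so the
  -- sum becomes the integral of a step function against `f'`.
  have hsum : ∀ n, ∑ i ∈ Finset.range (k n), f (s n i) * (x (s n (i + 1)) - x (s n i))
      = f t * x t - f 0 * x 0 - ∫ r in (0 : ℝ)..t, x (nextPoint (s n) r) * f' r := by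
    intro n
    rw [sum_mul_sub_eq (fun i => f (s n i)) (fun i => x (s n i)), hst, hs0]
    have h := intervalIntegral.sum_integral_adjacent_intervals (a := fun i => (s n i : ℝ))
      (n := k n) (fun i _ => intervalIntegrable_nextPoint (x := x) hf' (hs n) i)
    simp only [hst, hs0, NNReal.coe_zero] at h
    rw [← h]
    simp only [integral_nextPoint hf hf' (hs n), NNReal.coe_zero]
  simp_rw [hsum]
  refine tendsto_const_nhds.sub ?_
  have hmem : ∀ n, ∀ r ∈ Set.uIoc (0 : ℝ) t, ∃ i < k n,
      r ∈ Set.Ioc (s n i : ℝ) (s n (i + 1)) := by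
    intro n r hr
    rw [Set.uIoc_of_le (NNReal.coe_nonneg t)] at hr
    exact exists_mem_Ioc (hs0 n) hr.1 (by rw [hst]; exact hr.2)
  refine intervalIntegral.tendsto_integral_filter_of_dominated_convergence
    (fun r => C * |f' r|) (Eventually.of_forall fun n => ?_) (Eventually.of_forall fun n => ?_)
    ((hf'.abs.intervalIntegrable _ _).const_mul C) ?_
  · have h := IntervalIntegrable.trans_iterate (a := fun i => (s n i : ℝ)) (n := k n)
      (fun i _ => intervalIntegrable_nextPoint (x := x) hf' (hs n) i)
    simp only [hst, hs0, NNReal.coe_zero] at h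
    rw [Set.uIoc_of_le (NNReal.coe_nonneg t)]
    exact h.1.aestronglyMeasurable
  · refine ae_of_all _ fun r hr => ?_
    obtain ⟨i, hi, hri⟩ := hmem n r hr
    rw [nextPoint_eq (hs n) hri, norm_mul, Real.norm_eq_abs, Real.norm_eq_abs]
    exact mul_le_mul_of_nonneg_right (hC _ (hst n ▸ hs n hi)) (abs_nonneg _)
  · refine ae_of_all _ fun r hr => Tendsto.mul_const _ ?_
    have hr' := hr
    rw [Set.uIoc_of_le (NNReal.coe_nonneg t)] at hr'
    -- The next partition point approaches `r` from the right within the mesh, so right continuity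
    -- suffices.
    have hlim : Tendsto (fun n => nextPoint (s n) r) atTop (𝓝[≥] r.toNNReal) := by
      refine tendsto_nhdsWithin_iff.2 ⟨?_, Eventually.of_forall fun n => ?_⟩
      · rw [Metric.tendsto_atTop']
        intro ε hε
        obtain ⟨N, hN⟩ := eventually_atTop.1 (hmesh (ε / 2) (half_pos hε))
        refine ⟨N, fun n hn => ?_⟩
        obtain ⟨i, hi, hri⟩ := hmem n r hr
        rw [nextPoint_eq (hs n) hri, NNReal.dist_eq, Real.coe_toNNReal r hr'.1.le,
          abs_of_nonneg (sub_nonneg.2 hri.2)]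
        linarith [hN n hn.le i hi, hri.1]
      · obtain ⟨i, hi, hri⟩ := hmem n r hr
        rw [nextPoint_eq (hs n) hri, Set.mem_Ici, Real.toNNReal_le_iff_le_coe]
        exact hri.2
    exact (hx r.toNNReal).1.tendsto.comp hlim

end Path

/-- The uniform partition of `[0, t]` into `n + 1` intervals, continued by the constant `t`. -/
noncomputable def uniformPartition (t : ℝ≥0) (n i : ℕ) : ℝ≥0 :=
  t * (min i (n + 1) : ℕ) / (n + 1)

lemma monotone_uniformPartition (t : ℝ≥0) (n : ℕ) : Monotone (uniformPartition t n) := by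
  intro i j hij
  unfold uniformPartition
  gcongr

lemma uniformPartition_zero (t : ℝ≥0) (n : ℕ) : uniformPartition t n 0 = 0 := by
  simp [uniformPartition]

lemma uniformPartition_last (t : ℝ≥0) (n : ℕ) : uniformPartition t n (n + 1) = t := by
  have : (n : ℝ≥0) + 1 ≠ 0 := by positivity
  simp [uniformPartition, this]

lemma uniformPartition_mesh (t : ℝ≥0) (ε : ℝ) (hε : 0 < ε) : ∀ᶠ n in atTop, ∀ i < n + 1,
    (uniformPartition t n (i + 1) : ℝ) - uniformPartition t n i ≤ ε := by
  have h : Tendsto (fun n : ℕ => (t : ℝ) * (1 / ((n : ℝ) + 1))) atTop (𝓝 (t * 0)) :=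
    tendsto_one_div_add_atTop_nhds_zero_nat.const_mul _
  rw [mul_zero] at h
  filter_upwards [h.eventually_lt_const hε] with n hn i hi
  rw [uniformPartition, uniformPartition, min_eq_left (by omega), min_eq_left (by omega)]
  refine le_trans (le_of_eq ?_) hn.le
  push_cast
  ring

/-! ### The stochastic integral by parts. -/

section Integral

variable {Ω : Type*} [MeasurableSpace Ω] {P : Measure Ω}
  {z : ℝ≥0 → Ω → ℝ} {f f' : ℝ → ℝ}

/-- The integral `∫_0^t f dz` of a continuously differentiable function, by parts. -/
noncomputable def integralByParts (f f' : ℝ → ℝ) (z : ℝ≥0 → Ω → ℝ) (t : ℝ≥0) (ω : Ω) : ℝ :=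
  f t * z t ω - f 0 * z 0 ω - ∫ r in (0 : ℝ)..t, z r.toNNReal ω * f' r

lemma measurable_sum_increments (hm : ∀ t, Measurable (z t)) (f : ℝ → ℝ) (s : ℕ → ℝ≥0) (k : ℕ) :
    Measurable fun ω => ∑ i ∈ Finset.range k, f (s i) * (z (s (i + 1)) ω - z (s i) ω) :=
  Finset.measurable_sum _ fun _ _ => ((hm _).sub (hm _)).const_mul _

lemma ae_tendsto_uniformPartition (hz : IsLevyProcess z P) (hf : ∀ r, HasDerivAt f (f' r) r)
    (hf' : Continuous f') (t : ℝ≥0) : ∀ᵐ ω ∂P, Tendsto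
      (fun n : ℕ => ∑ i ∈ Finset.range (n + 1), f (uniformPartition t n i)
        * (z (uniformPartition t n (i + 1)) ω - z (uniformPartition t n i) ω)) atTop
      (𝓝 (integralByParts f f' z t ω)) := by
  filter_upwards [hz.cadlag] with ω hω
  exact tendsto_sum_mul_increments hf hf' hω (k := fun n => n + 1) (monotone_uniformPartition t)
    (uniformPartition_zero t) (uniformPartition_last t) (uniformPartition_mesh t)

lemma isStochIntegral_integralByParts [IsProbabilityMeasure P] (hz : IsLevyProcess z P)
    (hf : ∀ r, HasDerivAt f (f' r) r) (hf' : Continuous f') (t : ℝ≥0) :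
    IsStochIntegral f z t (integralByParts f f' z t) P := by
  refine ⟨aemeasurable_of_tendsto_metrizable_ae atTop
    (fun n => (measurable_sum_increments hz.measurable f (uniformPartition t n) (n + 1)).aemeasurable)
    (ae_tendsto_uniformPartition hz hf hf' t), fun k s hs hs0 hst hmesh => ?_⟩
  refine tendstoInMeasure_of_tendsto_ae
    (fun n => (measurable_sum_increments hz.measurable f (s n) (k n)).aestronglyMeasurable) ?_
  filter_upwards [hz.cadlag] with ω hω
  exact tendsto_sum_mul_increments hf hf' hω hs hs0 hst hmesh

end Integral

/-! ### From characteristic functions to tails and moments. -/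

section Tail

lemma one_sub_charFun_re_nonneg (μ : Measure ℝ) [IsProbabilityMeasure μ] (ξ : ℝ) :
    0 ≤ 1 - (charFun μ ξ).re := by
  linarith [Complex.re_le_norm (charFun μ ξ), norm_charFun_le_one (μ := μ) ξ]

/-- Over a symmetric interval the integral is real, since `charFun μ (-ξ)` is the conjugate of
`charFun μ ξ`. A bound on the real part alone is therefore enough. -/
lemma norm_integral_one_sub_charFun_le (μ : Measure ℝ) [IsProbabilityMeasure μ] {a B : ℝ}
    (ha : 0 ≤ a) (hB : ∀ ξ : ℝ, |ξ| ≤ a → 1 - (charFun μ ξ).re ≤ B) :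
    ‖∫ ξ in (-a)..a, (1 - charFun μ ξ)‖ ≤ B * (2 * a) := by
  set J := ∫ ξ in (-a)..a, (1 - charFun μ ξ) with hJ
  have hintegrable : IntervalIntegrable (fun ξ => 1 - charFun μ ξ) volume (-a) a := by
    refine Continuous.intervalIntegrable ?_ _ _
    exact continuous_const.sub (by fun_prop)
  have hconj : (starRingEnd ℂ) J = J := by
    have h1 : J = ∫ ξ in (-a)..a, (1 - charFun μ (-ξ)) := by
      rw [intervalIntegral.integral_comp_neg (fun ξ => 1 - charFun μ ξ), neg_neg]
    conv_rhs => rw [h1]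
    rw [hJ, intervalIntegral.integral_of_le (by linarith),
      intervalIntegral.integral_of_le (by linarith), ← integral_conj]
    simp [charFun_neg]
  have hre : J = ((∫ ξ in (-a)..a, (1 - (charFun μ ξ).re) : ℝ) : ℂ) := by
    rw [← Complex.conj_eq_iff_re.1 hconj, hJ]
    congr 1
    have := Complex.reCLM.intervalIntegral_comp_comm hintegrable
    simpa using this.symm
  rw [hre, Complex.norm_real]
  have := intervalIntegral.norm_integral_le_of_norm_le_const (a := -a) (b := a) (C := B)
    (f := fun ξ => 1 - (charFun μ ξ).re) (fun ξ hξ => ?_)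
  · rwa [show a - -a = 2 * a by ring, abs_of_nonneg (by positivity)] at this
  · rw [Set.uIoc_of_le (by linarith)] at hξ
    rw [Real.norm_of_nonneg (one_sub_charFun_re_nonneg μ ξ)]
    exact hB ξ (abs_le.2 ⟨hξ.1.le, hξ.2⟩)

/-- A Hölder bound on the real part of the characteristic function at the origin bounds the
tails. -/
lemma measure_lt_abs_le_of_charFun {α C : ℝ} (hα : 0 < α) (hC : 0 ≤ C) (μ : Measure ℝ)
    [IsProbabilityMeasure μ] (h : ∀ ξ : ℝ, |ξ| ≤ 1 → 1 - (charFun μ ξ).re ≤ C * |ξ| ^ α)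
    {r : ℝ} (hr : 2 ≤ r) : μ.real {x | r < |x|} ≤ 2 * C * 2 ^ α * r ^ (-α) := by
  have hr0 : 0 < r := by linarith
  -- The tail inequality integrates over `|ξ| ≤ 2 / r`, which must lie in the range of `h`.
  have ha : 2 * r⁻¹ ≤ 1 := by
    rw [← div_eq_mul_inv, div_le_one hr0]; exact hr
  have h1 := norm_integral_one_sub_charFun_le μ (a := 2 * r⁻¹) (B := C * (2 * r⁻¹) ^ α)
    (by positivity) (fun ξ hξ => (h ξ (hξ.trans ha)).trans (by gcongr))
  refine (measureReal_abs_gt_le_integral_charFun hr0).trans ?_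
  rw [neg_mul]
  calc 2⁻¹ * r * ‖∫ t in (-(2 * r⁻¹))..(2 * r⁻¹), 1 - charFun μ t‖
      ≤ 2⁻¹ * r * (C * (2 * r⁻¹) ^ α * (2 * (2 * r⁻¹))) := by gcongr
    _ = _ := by
      rw [Real.mul_rpow (by norm_num) (by positivity), Real.inv_rpow hr0.le, Real.rpow_neg hr0.le]
      field_simp

/-- A uniform bound on absolute moments of order below `α`. -/
lemma exists_moment_bound {α C p : ℝ} (hα : 0 < α) (hC : 0 ≤ C) (hp : 0 < p) (hpα : p < α) :
    ∃ B : ℝ≥0∞, B < ∞ ∧ ∀ μ : Measure ℝ, IsProbabilityMeasure μ →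
      (∀ ξ : ℝ, |ξ| ≤ 1 → 1 - (charFun μ ξ).re ≤ C * |ξ| ^ α) →
      ∫⁻ x, ‖x‖ₑ ^ p ∂μ ≤ B := by
  set D := 2 * C * 2 ^ α
  have hD : 0 ≤ D := by positivity
  have hsmall : IntegrableOn (fun r : ℝ => r ^ (p - 1)) (Set.Ioc 0 2) := by
    rw [← intervalIntegrable_iff_integrableOn_Ioc_of_le (by norm_num)]
    exact intervalIntegral.intervalIntegrable_rpow' (by linarith)
  have hlarge : IntegrableOn (fun r : ℝ => D * r ^ (p - 1 - α)) (Set.Ioi 2) :=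
    (integrableOn_Ioi_rpow_of_lt (by linarith) (by norm_num)).const_mul D
  -- Layer-cake formula split at `2`: probabilities are bounded by `1` below and by the tail
  -- estimate above. The bound involves only `α`, `C` and `p`.
  refine ⟨ENNReal.ofReal p * ((∫⁻ r in Set.Ioc (0 : ℝ) 2, ENNReal.ofReal (r ^ (p - 1)))
    + ∫⁻ r in Set.Ioi (2 : ℝ), ENNReal.ofReal (D * r ^ (p - 1 - α))), ?_, fun μ _ h => ?_⟩
  · exact ENNReal.mul_lt_top ENNReal.ofReal_lt_top
      (ENNReal.add_lt_top.2 ⟨hsmall.lintegral_lt_top, hlarge.lintegral_lt_top⟩)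
  · have hnorm : ∀ x : ℝ, ‖x‖ₑ ^ p = ENNReal.ofReal (|x| ^ p) := fun x => by
      rw [← ENNReal.ofReal_rpow_of_nonneg (abs_nonneg x) hp.le, Real.enorm_eq_ofReal_abs]
    simp_rw [hnorm]
    rw [lintegral_rpow_eq_lintegral_meas_lt_mul μ (ae_of_all _ fun x => abs_nonneg x)
      (by fun_prop) hp]
    gcongr
    rw [← Set.Ioc_union_Ioi_eq_Ioi (show (0 : ℝ) ≤ 2 by norm_num)]
    refine (lintegral_union_le _ _ _).trans (add_le_add ?_ ?_)
    · refine setLIntegral_mono (by fun_prop) fun r _ => ?_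
      exact (mul_le_mul_left prob_le_one _).trans_eq (one_mul _)
    · refine setLIntegral_mono (by fun_prop) fun r hr => ?_
      have hr2 : (2 : ℝ) < r := hr
      have hr0 : 0 < r := by linarith
      have ht := measure_lt_abs_le_of_charFun hα hC μ h hr2.le
      rw [← ofReal_measureReal (measure_ne_top μ _), ← ENNReal.ofReal_mul measureReal_nonneg]
      refine ENNReal.ofReal_le_ofReal ?_
      calc _ ≤ D * r ^ (-α) * r ^ (p - 1) := by gcongr
        _ = D * r ^ (p - 1 - α) := by
          rw [mul_assoc, ← Real.rpow_add hr0]; congr 2; ring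

end Tail

/-! ### Size of the symbol near the origin. -/

lemma min_two_le_rpow {θ β : ℝ} (hθ : 0 ≤ θ) (hβ0 : 0 < β) (hβ1 : β ≤ 1) :
    min 2 θ ≤ 2 * θ ^ β := by
  rcases le_total θ 1 with h | h
  · have : θ ≤ θ ^ β := by
      rcases hθ.eq_or_lt with rfl | h0
      · rw [Real.zero_rpow hβ0.ne']
      · simpa using Real.rpow_le_rpow_of_exponent_ge h0 h hβ1
    have := Real.rpow_nonneg hθ β
    exact (min_le_right _ _).trans (by linarith)
  · have := Real.one_le_rpow h hβ0.le
    exact (min_le_left _ _).trans (by linarith)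

/-- The symbol is Hölder continuous at the origin as soon as the large jumps have a moment. -/
lemma exists_norm_levySymbol_le {ν : Measure ℝ} (hν : IsLevyMeasure ν) (b : ℝ) {β : ℝ}
    (hβ0 : 0 < β) (hβ1 : β ≤ 1) (hi : IntegrableOn (fun x => |x| ^ β) (bigJumps 1) ν) :
    ∃ C : ℝ, 0 ≤ C ∧ ∀ ξ : ℝ, |ξ| ≤ 1 → ‖levySymbol b ν ξ‖ ≤ C * |ξ| ^ β := by
  -- An integrable majorant of the compensated exponential after division by `|ξ| ^ β`: quadratic
  -- for small jumps, of order `|y| ^ β` for large ones.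
  set g : ℝ → ℝ := fun y => 3 * min 1 (y ^ 2) + 2 * (bigJumps 1).indicator (fun x => |x| ^ β) y
  have hg0 : ∀ y, 0 ≤ g y := fun y => by
    have : 0 ≤ (bigJumps 1).indicator (fun x => |x| ^ β) y :=
      Set.indicator_nonneg (fun x _ => by positivity) y
    positivity
  have hg : Integrable g ν := (hν.integrable_min.const_mul 3).add
    ((hi.integrable_indicator (measurableSet_bigJumps 1)).const_mul 2)
  have hG : 0 ≤ ∫ y, g y ∂ν := integral_nonneg hg0
  refine ⟨|b| + ∫ y, g y ∂ν, by positivity, fun ξ hξ => ?_⟩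
  have hpow : |ξ| ≤ |ξ| ^ β := by
    rcases (abs_nonneg ξ).eq_or_lt with h | h
    · rw [← h, Real.zero_rpow hβ0.ne']
    · simpa using Real.rpow_le_rpow_of_exponent_ge h hξ hβ1
  have hpow0 : 0 ≤ |ξ| ^ β := by positivity
  have hpt : ∀ y, ‖compensatedExp ξ y‖ ≤ |ξ| ^ β * g y := by
    intro y
    rcases le_or_gt |y| 1 with hy | hy
    · have h1 := norm_compensatedExp_le_of_abs_le_one ξ hy
      have hy2 : y ^ 2 ≤ 1 := by rw [← sq_abs]; nlinarith [abs_nonneg y]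
      have hξ2 : ξ ^ 2 ≤ |ξ| ^ β := by
        rw [← sq_abs]; nlinarith [abs_nonneg ξ]
      have h2 : 3 * y ^ 2 ≤ g y := by
        simp only [g, min_eq_right hy2]
        have : 0 ≤ (bigJumps 1).indicator (fun x => |x| ^ β) y :=
          Set.indicator_nonneg (fun x _ => by positivity) y
        linarith
      calc _ ≤ 3 * (ξ * y) ^ 2 := h1
        _ = ξ ^ 2 * (3 * y ^ 2) := by ring
        _ ≤ _ := by gcongr
    · have h1 := norm_compensatedExp_le_of_one_lt_abs ξ hy
      have h2 : 2 * |y| ^ β ≤ g y := by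
        simp only [g, Set.indicator_of_mem (mem_bigJumps.2 hy.le)]
        have : 0 ≤ min 1 (y ^ 2) := by positivity
        linarith
      calc _ ≤ min 2 |ξ * y| := h1
        _ ≤ 2 * |ξ * y| ^ β := min_two_le_rpow (abs_nonneg _) hβ0 hβ1
        _ = |ξ| ^ β * (2 * |y| ^ β) := by
          rw [abs_mul, Real.mul_rpow (abs_nonneg _) (abs_nonneg _)]; ring
        _ ≤ _ := by gcongr
  have hnorm_integral : ‖∫ y, compensatedExp ξ y ∂ν‖ ≤ |ξ| ^ β * ∫ y, g y ∂ν := by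
    rw [← integral_const_mul]
    exact norm_integral_le_of_norm_le (hg.const_mul _) (ae_of_all _ hpt)
  rw [levySymbol_eq]
  refine (norm_add_le _ _).trans ?_
  have hd : ‖Complex.I * (b : ℂ) * ξ‖ = |b| * |ξ| := by simp
  rw [hd]
  nlinarith [mul_le_mul_of_nonneg_left hpow (abs_nonneg b)]

/-! ### Uniform moments of the Ornstein-Uhlenbeck integrals. -/

section Stable

variable {Ω : Type*} [MeasurableSpace Ω] {P : Measure Ω}
  {z : ℝ≥0 → Ω → ℝ} {ν : Measure ℝ} {α b : ℝ}

lemma levySymbol_zero (b : ℝ) (ν : Measure ℝ) : levySymbol b ν 0 = 0 := by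
  simp [levySymbol]

lemma levySymbol_re_nonpos [IsProbabilityMeasure P] (hm : Measurable (z 1))
    (hb : ∀ (t : ℝ≥0) (ξ : ℝ), charFun (P.map (z t)) ξ = Complex.exp ((t : ℝ) * levySymbol b ν ξ))
    (ξ : ℝ) : (levySymbol b ν ξ).re ≤ 0 := by
  have := Measure.isProbabilityMeasure_map (μ := P) hm.aemeasurable
  have h := norm_charFun_le_one (μ := P.map (z 1)) ξ
  rw [hb, Complex.norm_exp] at h
  simpa using h

/-- The drift in the scaling relation is purely imaginary, so the real part is exactly homogeneous
and determined by its values at `1` and `-1`. -/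
lemma exists_abs_re_levySymbol_le (hα : 0 < α) (hm : ∀ t, Measurable (z t))
    (hb : ∀ (t : ℝ≥0) (ξ : ℝ), charFun (P.map (z t)) ξ = Complex.exp ((t : ℝ) * levySymbol b ν ξ))
    (hs : IsStableProcess α z P) :
    ∃ C : ℝ, 0 ≤ C ∧ ∀ ξ : ℝ, |(levySymbol b ν ξ).re| ≤ C * |ξ| ^ α := by
  have hscale : ∀ s : ℝ, 0 < s → ∀ ξ : ℝ,
      (levySymbol b ν (s * ξ)).re = s ^ α * (levySymbol b ν ξ).re := by
    intro s hs0 ξ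
    obtain ⟨c, hc⟩ := exists_levySymbol_scaling hα hm hb hs hs0
    rw [hc]
    simp
  refine ⟨max |(levySymbol b ν 1).re| |(levySymbol b ν (-1)).re|, by positivity, fun ξ => ?_⟩
  rcases lt_trichotomy ξ 0 with h | rfl | h
  · have hneg : 0 < -ξ := neg_pos.2 h
    have := hscale (-ξ) hneg (-1)
    rw [mul_neg_one, neg_neg] at this
    rw [this, abs_of_neg h, abs_mul, abs_of_nonneg (by positivity), mul_comm]
    gcongr
    exact le_max_right _ _
  · rw [levySymbol_zero]
    simp only [Complex.zero_re, abs_zero]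
    positivity
  · have := hscale ξ h 1
    rw [mul_one] at this
    rw [this, abs_of_pos h, abs_mul, abs_of_nonneg (by positivity), mul_comm]
    gcongr
    exact le_max_left _ _

lemma charFun_map_increment (hz : IsLevyProcess z P)
    (hb : ∀ (t : ℝ≥0) (ξ : ℝ), charFun (P.map (z t)) ξ = Complex.exp ((t : ℝ) * levySymbol b ν ξ))
    {r s : ℝ≥0} (hrs : r ≤ s) (ξ : ℝ) :
    charFun (P.map fun ω => z s ω - z r ω) ξ
      = Complex.exp (((s : ℝ) - r) * levySymbol b ν ξ) := by
  have h1 := hz.stationary r (s - r)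
  rw [add_tsub_cancel_of_le hrs] at h1
  have h2 : P.map (fun ω => z (s - r) ω - z 0 ω) = P.map (z (s - r)) := by
    refine Measure.map_congr ?_
    filter_upwards [hz.zero] with ω hω
    rw [hω, sub_zero]
  rw [h1, h2, hb, NNReal.coe_sub hrs]
  push_cast
  rfl

lemma charFun_map_sum_increments (hz : IsLevyProcess z P)
    (hb : ∀ (t : ℝ≥0) (ξ : ℝ), charFun (P.map (z t)) ξ = Complex.exp ((t : ℝ) * levySymbol b ν ξ))
    {s : ℕ → ℝ≥0} (hs : Monotone s) (w : ℕ → ℝ) (k : ℕ) (ξ : ℝ) :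
    charFun (P.map fun ω => ∑ i ∈ Finset.range k, w i * (z (s (i + 1)) ω - z (s i) ω)) ξ
      = Complex.exp (∑ i ∈ Finset.range k,
        ((s (i + 1) : ℝ) - s i) * levySymbol b ν (w i * ξ)) := by
  have hmeas : ∀ i, Measurable fun ω => z (s (i + 1)) ω - z (s i) ω :=
    fun i => (hz.measurable _).sub (hz.measurable _)
  have hind : iIndepFun (fun i ω => w i * (z (s (i + 1)) ω - z (s i) ω)) P :=
    (hz.indep.nat hs).comp (fun i x => w i * x) fun i => by fun_prop
  rw [iIndepFun.charFun_map_fun_finsetSum_eq_prod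
      (fun i _ => ((hmeas i).const_mul (w i)).aemeasurable)
      (hind.precomp (g := fun i : Finset.range k => (i : ℕ)) Subtype.val_injective),
    Finset.prod_apply, Complex.exp_sum]
  refine Finset.prod_congr rfl fun i _ => ?_
  rw [charFun_map_mul_comp (hmeas i).aemeasurable,
    charFun_map_increment hz hb (hs (Nat.le_succ i))]

/-- The imaginary part enters only through its square, so a bound of order `|ξ| ^ (α / 2)` on it is
good enough. -/
lemma one_sub_re_exp_le {w : ℂ} (hw : w.re ≤ 0) :
    1 - (Complex.exp w).re ≤ |w.re| + w.im ^ 2 / 2 := by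
  rw [Complex.exp_re]
  have h1 := Real.add_one_le_exp w.re
  have h2 := Real.exp_le_one_iff.2 hw
  have h3 := Real.one_sub_sq_div_two_le_cos (x := w.im)
  have h4 := Real.exp_pos w.re
  rw [abs_of_nonpos hw]
  nlinarith [Real.cos_le_one w.im, sq_nonneg w.im]

/-- The left-endpoint sums of `e^{-c(t-s)}` are bounded by its integral over `(-∞, t]`. -/
lemma sum_increment_mul_exp_le {c : ℝ} (hc : 0 < c) {s : ℕ → ℝ≥0} (k : ℕ)
    {t : ℝ} (hst : (s k : ℝ) = t) :
    ∑ i ∈ Finset.range k, ((s (i + 1) : ℝ) - s i) * Real.exp (-c * (t - s i)) ≤ 1 / c := by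
  -- From `x + 1 ≤ e^x`; the right-hand sides telescope.
  have hterm : ∀ i, ((s (i + 1) : ℝ) - s i) * Real.exp (-c * (t - s i))
      ≤ 1 / c * (Real.exp (-c * (t - s (i + 1))) - Real.exp (-c * (t - s i))) := by
    intro i
    have h1 : Real.exp (-c * (t - s (i + 1)))
        = Real.exp (-c * (t - s i)) * Real.exp (c * ((s (i + 1) : ℝ) - s i)) := by
      rw [← Real.exp_add]; congr 1; ring
    have h2 := Real.add_one_le_exp (c * ((s (i + 1) : ℝ) - s i))
    have h3 := Real.exp_pos (-c * (t - s i))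
    rw [h1, div_mul_eq_mul_div, one_mul, le_div_iff₀ hc]
    nlinarith
  refine (Finset.sum_le_sum fun i _ => hterm i).trans ?_
  rw [← Finset.mul_sum, Finset.sum_range_sub (fun i => Real.exp (-c * (t - s i))), hst, sub_self,
    mul_zero, Real.exp_zero]
  have := Real.exp_pos (-c * (t - s 0))
  have : 0 < 1 / c := by positivity
  nlinarith

/-- The characteristic functions of the left-endpoint sums of `∫_0^t e^{-λ(t-s)} dz(s)` satisfy a
Hölder bound at the origin that is uniform in `t` and in the partition. -/
lemma exists_charFun_sum_exp_bound [IsProbabilityMeasure P] (hα0 : 0 < α) (hα2 : α < 2)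
    (hz : IsLevyProcess z P)
    (hν : IsLevyMeasure ν)
    (hb : ∀ (t : ℝ≥0) (ξ : ℝ), charFun (P.map (z t)) ξ = Complex.exp ((t : ℝ) * levySymbol b ν ξ))
    (hs : IsStableProcess α z P) {lam : ℝ} (hlam : 0 < lam) :
    ∃ C : ℝ, 0 ≤ C ∧ ∀ (t : ℝ≥0) (s : ℕ → ℝ≥0) (k : ℕ), Monotone s → s k = t →
      ∀ ξ : ℝ, |ξ| ≤ 1 →
        1 - (charFun (P.map fun ω => ∑ i ∈ Finset.range k,
          Real.exp (-lam * (t - s i)) * (z (s (i + 1)) ω - z (s i) ω)) ξ).re ≤ C * |ξ| ^ α := by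
  have hom : ∀ s : ℝ, 0 < s → ν.map (fun x => s * x) = ENNReal.ofReal (s ^ α) • ν :=
    fun s hs0 => map_mul_eq_of_stable hα0 hν hz.measurable hb hs hs0
  obtain ⟨C₁, hC₁, hre⟩ := exists_abs_re_levySymbol_le hα0 hz.measurable hb hs
  -- The order `α / 2` lies below `α`, so the large jumps have this moment; it is at most `1`
  -- because `α < 2`, and squaring returns `α`.
  obtain ⟨C₂, hC₂, hnorm⟩ := exists_norm_levySymbol_le hν b (half_pos hα0) (by linarith)
    (integrableOn_abs_rpow_bigJumps hα0 hν hom one_pos (half_lt_self hα0))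
  refine ⟨C₁ * (1 / (lam * α)) + (C₂ * (1 / (lam * (α / 2)))) ^ 2 / 2, by positivity,
    fun t s k hmono hst ξ hξ => ?_⟩
  set w : ℕ → ℝ := fun i => Real.exp (-lam * (t - s i)) with hw
  have hΔ : ∀ i, 0 ≤ (s (i + 1) : ℝ) - s i := fun i => by
    have : (s i : ℝ) ≤ s (i + 1) := by exact_mod_cast hmono (Nat.le_succ i)
    linarith
  have hwpos : ∀ i, 0 < w i := fun i => Real.exp_pos _
  have hw1 : ∀ i ∈ Finset.range k, w i ≤ 1 := fun i hi => by
    have : (s i : ℝ) ≤ t := by rw [← hst]; exact_mod_cast hmono (Finset.mem_range.1 hi).le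
    exact Real.exp_le_one_iff.2 (by nlinarith)
  -- Raising the weights to the power `q` replaces the rate `lam` by `lam * q`; the bound is
  -- independent of `t` and of the partition.
  have hpow : ∀ (q : ℝ), 0 < q →
      ∑ i ∈ Finset.range k, ((s (i + 1) : ℝ) - s i) * w i ^ q ≤ 1 / (lam * q) := by
    intro q hq
    refine le_trans (le_of_eq (Finset.sum_congr rfl fun i _ => ?_))
      (sum_increment_mul_exp_le (c := lam * q) (s := s) (by positivity) k (t := t) (by rw [hst]))
    rw [hw, ← Real.exp_mul]
    congr 2
    ring
  set W : ℂ := ∑ i ∈ Finset.range k, ((s (i + 1) : ℝ) - s i) * levySymbol b ν (w i * ξ) with hW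
  have hterm : ∀ i, (((s (i + 1) : ℝ) : ℂ) - ((s i : ℝ) : ℂ)) = (((s (i + 1) : ℝ) - s i : ℝ) : ℂ) :=
    fun i => by push_cast; rfl
  have hWre : W.re = ∑ i ∈ Finset.range k,
      ((s (i + 1) : ℝ) - s i) * (levySymbol b ν (w i * ξ)).re := by
    rw [hW, Complex.re_sum]
    exact Finset.sum_congr rfl fun i _ => by rw [hterm, Complex.re_ofReal_mul]
  have hre0 : W.re ≤ 0 := by
    rw [hWre]
    exact Finset.sum_nonpos fun i _ => mul_nonpos_of_nonneg_of_nonpos (hΔ i)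
      (levySymbol_re_nonpos (hz.measurable 1) hb _)
  have habs : |W.re| ≤ C₁ * (1 / (lam * α)) * |ξ| ^ α := by
    rw [hWre]
    calc _ ≤ ∑ i ∈ Finset.range k, |((s (i + 1) : ℝ) - s i) * (levySymbol b ν (w i * ξ)).re| :=
          Finset.abs_sum_le_sum_abs _ _
      _ ≤ ∑ i ∈ Finset.range k, C₁ * |ξ| ^ α * (((s (i + 1) : ℝ) - s i) * w i ^ α) := by
          refine Finset.sum_le_sum fun i _ => ?_
          rw [abs_mul, abs_of_nonneg (hΔ i)]
          refine (mul_le_mul_of_nonneg_left (hre _) (hΔ i)).trans_eq ?_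
          rw [abs_mul, abs_of_pos (hwpos i), Real.mul_rpow (hwpos i).le (abs_nonneg ξ)]
          ring
      _ ≤ C₁ * |ξ| ^ α * (1 / (lam * α)) := by
          rw [← Finset.mul_sum]
          exact mul_le_mul_of_nonneg_left (hpow α hα0) (by positivity)
      _ = _ := by ring
  have him : |W.im| ≤ C₂ * (1 / (lam * (α / 2))) * |ξ| ^ (α / 2) := by
    calc |W.im| ≤ ‖W‖ := Complex.abs_im_le_norm W
      _ ≤ ∑ i ∈ Finset.range k, ‖((s (i + 1) : ℝ) - s i) * levySymbol b ν (w i * ξ)‖ :=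
          norm_sum_le _ _
      _ ≤ ∑ i ∈ Finset.range k,
          C₂ * |ξ| ^ (α / 2) * (((s (i + 1) : ℝ) - s i) * w i ^ (α / 2)) := by
          refine Finset.sum_le_sum fun i hi => ?_
          have hle : |w i * ξ| ≤ 1 := by
            rw [abs_mul, abs_of_pos (hwpos i)]
            exact mul_le_one₀ (hw1 i hi) (abs_nonneg ξ) hξ
          rw [norm_mul, hterm, Complex.norm_real, Real.norm_of_nonneg (hΔ i)]
          refine (mul_le_mul_of_nonneg_left (hnorm _ hle) (hΔ i)).trans_eq ?_
          rw [abs_mul, abs_of_pos (hwpos i), Real.mul_rpow (hwpos i).le (abs_nonneg ξ)]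
          ring
      _ ≤ C₂ * |ξ| ^ (α / 2) * (1 / (lam * (α / 2))) := by
          rw [← Finset.mul_sum]
          exact mul_le_mul_of_nonneg_left (hpow (α / 2) (half_pos hα0)) (by positivity)
      _ = _ := by ring
  have him2 : W.im ^ 2 ≤ (C₂ * (1 / (lam * (α / 2)))) ^ 2 * |ξ| ^ α := by
    rw [← sq_abs]
    refine (pow_le_pow_left₀ (abs_nonneg _) him 2).trans_eq ?_
    rw [mul_pow, ← Real.rpow_natCast (|ξ| ^ (α / 2)), ← Real.rpow_mul (abs_nonneg ξ)]
    congr 2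
    push_cast
    ring
  rw [charFun_map_sum_increments hz hb hmono w k ξ]
  refine (one_sub_re_exp_le hre0).trans ?_
  linarith

lemma hasDerivAt_exp_neg_mul_sub (lam t r : ℝ) :
    HasDerivAt (fun s => Real.exp (-lam * (t - s))) (lam * Real.exp (-lam * (t - r))) r := by
  have h : HasDerivAt (fun s : ℝ => -lam * (t - s)) (-lam * (0 - 1)) r :=
    ((hasDerivAt_const r t).sub (hasDerivAt_id r)).const_mul _
  convert h.exp using 1
  ring

/-- The Ornstein-Uhlenbeck integrals `∫_0^t e^{-λ(t-s)} dz(s)` exist and have bounded moments of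
every order below `α`. -/
lemma exists_stochIntegral_exp [IsProbabilityMeasure P] (hα0 : 0 < α) (hα2 : α < 2)
    (hz : IsLevyProcess z P)
    (hν : IsLevyMeasure ν)
    (hb : ∀ (t : ℝ≥0) (ξ : ℝ), charFun (P.map (z t)) ξ = Complex.exp ((t : ℝ) * levySymbol b ν ξ))
    (hs : IsStableProcess α z P) {lam : ℝ} (hlam : 0 < lam) :
    ∃ Y : ℝ≥0 → Ω → ℝ,
      (∀ t : ℝ≥0, IsStochIntegral (fun s => Real.exp (-lam * (t - s))) z t (Y t) P) ∧
      ∀ p : ℝ, 0 < p → p < α → (⨆ t : ℝ≥0, ∫⁻ ω, ‖Y t ω‖ₑ ^ p ∂P) < ∞ := by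
  have hderiv := fun t : ℝ≥0 => hasDerivAt_exp_neg_mul_sub lam t
  have hcont : ∀ t : ℝ≥0, Continuous fun r : ℝ => lam * Real.exp (-lam * (t - r)) :=
    fun t => by fun_prop
  refine ⟨fun t => integralByParts (fun s => Real.exp (-lam * (t - s)))
    (fun r => lam * Real.exp (-lam * (t - r))) z t,
    fun t => isStochIntegral_integralByParts hz (hderiv t) (hcont t) t, fun p hp hpα => ?_⟩
  obtain ⟨C, hC, hchar⟩ := exists_charFun_sum_exp_bound hα0 hα2 hz hν hb hs hlam
  obtain ⟨B, hB, hmom⟩ := exists_moment_bound hα0 hC hp hpα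
  refine (iSup_le fun t => ?_).trans_lt hB
  set S : ℕ → Ω → ℝ := fun n ω => ∑ i ∈ Finset.range (n + 1),
    Real.exp (-lam * (t - uniformPartition t n i))
      * (z (uniformPartition t n (i + 1)) ω - z (uniformPartition t n i) ω) with hS
  have hSm : ∀ n, Measurable (S n) := fun n =>
    measurable_sum_increments hz.measurable (fun s => Real.exp (-lam * (t - s)))
      (uniformPartition t n) (n + 1)
  have hSB : ∀ n, ∫⁻ ω, ‖S n ω‖ₑ ^ p ∂P ≤ B := by
    intro n
    have := hmom (P.map (S n)) (Measure.isProbabilityMeasure_map (hSm n).aemeasurable)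
      (hchar t (uniformPartition t n) (n + 1) (monotone_uniformPartition t n)
        (uniformPartition_last t n))
    rwa [lintegral_map (by fun_prop) (hSm n)] at this
  -- Fatou's lemma along the uniform partitions, whose sums converge almost surely.
  calc _ = ∫⁻ ω, liminf (fun n => ‖S n ω‖ₑ ^ p) atTop ∂P := by
        refine lintegral_congr_ae ?_
        filter_upwards [ae_tendsto_uniformPartition hz (hderiv t) (hcont t) t] with ω hω
        exact (((ENNReal.continuous_rpow_const.comp continuous_enorm).tendsto _).comp
          hω).liminf_eq.symm
    _ ≤ liminf (fun n => ∫⁻ ω, ‖S n ω‖ₑ ^ p ∂P) atTop :=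
        lintegral_liminf_le fun n => (hSm n).enorm.pow_const p
    _ ≤ liminf (fun _ : ℕ => B) atTop := liminf_le_liminf (Eventually.of_forall hSB)
    _ = B := by simp

end Stable

/-! ### Choice of the constants and conclusion. -/

lemma lipSeminorm_le {F : Plane → Plane} {L : ℝ≥0} (hF : LipschitzWith L F) :
    lipSeminorm F ≤ L := by
  refine Real.sSup_le ?_ L.2
  rintro r ⟨x, y, hxy, rfl⟩
  rw [div_le_iff₀ (norm_pos_iff.2 (sub_ne_zero.2 hxy)), ← dist_eq_norm, ← dist_eq_norm]
  exact hF.dist_le_mul x y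

end StableNoise

open StableNoise

theorem proposition2p3 {Ω : Type*} [MeasurableSpace Ω] (P : Measure Ω) [IsProbabilityMeasure P]
    (α : ℝ) (hα0 : 0 < α) (hα2 : α < 2) (z : ℝ≥0 → Ω → ℝ) (ν : Measure ℝ)
    (hz : StableNoise.IsJumpLevyProcess z ν P) (hstable : StableNoise.IsStableProcess α z P) :
    ∃ (pK : ℝ → ℝ → ℝ) (β₁ β₂ : ℝ → ℝ) (β₀ : ℝ → ℝ → ℝ),
      ∀ F : StableNoise.Plane → StableNoise.Plane, (∃ C : ℝ, ∀ x, ‖F x‖ ≤ C) →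
        (∃ L : ℝ≥0, LipschitzWith L F) →
        ∃ K₀ : ℝ, 0 < K₀ ∧ ∀ K : ℝ, 0 < K → K ≤ K₀ → ∀ M : ℝ, 0 < M →
          StableNoise.NoiseAssumption α z ν P F K (pK K) M (β₀ K M) (β₁ K) (β₂ K) := by
  obtain ⟨b, hb⟩ := hz.charFun_eq
  have hL := hz.isLevyProcess
  have hν := hz.isLevyMeasure
  have hom : ∀ s : ℝ, 0 < s → ν.map (fun x => s * x) = ENNReal.ofReal (s ^ α) • ν :=
    fun s hs0 => map_mul_eq_of_stable hα0 hν hL.measurable hb hstable hs0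
  have hne : ν ≠ 0 := ne_zero_of_stable (hL.measurable 1) hb hstable
  have hbig : ∀ K : ℝ, 0 < K → ν (bigJumps K) ≠ 0 := fun K hK =>
    apply_bigJumps_ne_zero hν hne hom hK
  have hγ : 0 < jumpRate ν 1 :=
    ENNReal.toReal_pos (hbig 1 one_pos) (hν.apply_bigJumps_ne_top one_pos)
  refine ⟨jumpDensity ν α, fun K => 2 * α / K, fun _ => 1,
    fun K M => 2 * (1 - (K / (K + M)) ^ α), ?_⟩
  rintro F - ⟨L, hF⟩
  have hL0 : (0 : ℝ) < 2 * L + 1 := by have := L.2; positivity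
  -- For `K` below this threshold, `γ_K = K^(-α) γ_1 ≥ 2L + 1`. The added `1` keeps the denominator
  -- positive when `L = 0`.
  refine ⟨(jumpRate ν 1 / (2 * L + 1)) ^ α⁻¹, by positivity, fun K hK hK₀ M hM => ?_⟩
  have hfrac1 : (K / (K + M)) ^ α < 1 :=
    Real.rpow_lt_one (by positivity) ((div_lt_one (by positivity)).2 (by linarith)) hα0
  have hfrac0 : 0 < (K / (K + M)) ^ α := by positivity
  refine
    { K_pos := hK
      M_pos := hM
      β₀_pos := by linarith
      β₀_lt := by linarith
      β₁_pos := by positivity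
      β₂_pos := one_pos
      density := isDensity_jumpDensity hα0 hν hne hom hK
      A1 := fun lam hlam => exists_stochIntegral_exp hα0 hα2 hL hν hb hstable hlam
      A2 := fun z₁ z₂ => ?_
      A3 := fun z₁ z₂ hM' => ?_
      A4 := ?_ }
  · rw [Real.rpow_one]
    exact (integral_abs_jumpDensity_sub_le hα0 hν hK (hbig K hK) z₁ z₂).trans
      (integral_abs_paretoPDFReal_sub_le hK hα0 z₁ z₂)
  · refine (integral_abs_jumpDensity_sub_le hα0 hν hK (hbig K hK) z₁ z₂).trans ?_
    rw [integral_abs_paretoPDFReal_sub_eq hK hα0]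
    -- The exact Pareto distance increases with `|z₁ - z₂|`, so its value at `M` bounds it.
    have hd : |z₁ - z₂| ≤ M := (abs_sub _ _).trans hM'
    change _ ≤ 2 * (1 - (K / (K + M)) ^ α)
    gcongr
  · have hrate : jumpRate ν K = K⁻¹ ^ α * jumpRate ν 1 := by
      rw [jumpRate, apply_bigJumps_of_homogeneous hom hK, ENNReal.toReal_mul,
        ENNReal.toReal_ofReal (by positivity), jumpRate]
    have hKα : K ^ α ≤ jumpRate ν 1 / (2 * L + 1) := by
      refine (Real.rpow_le_rpow hK.le hK₀ hα0.le).trans_eq ?_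
      rw [← Real.rpow_mul (by positivity), inv_mul_cancel₀ hα0.ne', Real.rpow_one]
    rw [le_div_iff₀ hL0] at hKα
    have hlip := lipSeminorm_le hF
    have hKpos : 0 < K ^ α := by positivity
    rw [hrate, Real.inv_rpow hK.le, inv_mul_eq_div, le_div_iff₀ hKpos]
    nlinarith
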